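/- Let $K,N\ge 1$ be integers. Let $F_\infty\in\mathbb C$ with $|F_\infty|=1$, $F_\infty\neq 1$, and let $\xi_1,\dots,\xi_N,\eta_1,\dots,\eta_K\in\mathbb C$ have positive imaginary parts and real parts in $(-\pi/2,\pi/2]$, with $\{\eta_1,\dots,\eta_K\}=\{-\overline{\eta_1},\dots,-\overline{\eta_K}\}$ as multisets. For $M\ge 0$ and $v=(v_1,\dots,v_M)\in\mathbb C^M$ put $Q(u|v)=\prod_{m=1}^M\sin(u-v_m)$ and $$\mathcal Q(u|v)=F_\infty\prod_{n=1}^N\sin(u+\xi_n)\prod_{k=1}^K Q(u+\eta_k|v)+(-1)^{K+1}\prod_{n=1}^N\sin(u+\overline{\xi_n})\prod_{k=1}^K Q(u+\overline{\eta_k}|v).$$ The vector $v$ is a solution of the strong trigonometric generalized Bethe equations if the meromorphic function $u\mapsto \mathcal Q(u|v)/Q(u|v)$ is entire (its singularities at the zeros of $Q(\cdot|v)$ are all removable). Two solutions are regarded as the same if they differ by a permutation of $v_1,\dots,v_M$ and by shifts of the $v_j$ by integer multiples of $\pi$; otherwise they are distinct. For every such choice of parameters and every $M\ge 0$, the number of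 distinct solutions is finite and equal to $$C_M^{(K,N)}=\frac{N}{KM+N}\binom{KM+N}{M},$$ which for $M\ge 1$ also equals $\frac NM\binom{KM+N-1}{M-1}$. For $N=1$ these are the Fuss–Catalan numbers, $C_M^{(K,1)}=\frac{1}{(K-1)M+1}\binom{KM}{M}$. Moreover, as formal power series in $t$, $$\sum_{M=0}^\infty C_M^{(K,N)}t^M=\Bigl(\sum_{M=0}^\infty C_M^{(K,1)}t^M\Bigr)^N .$$ -/

import Mathlib

open scoped ComplexConjugate

/-- The data of the trigonometric generalized Bethe equations with `N` parameters `ξ` and `K`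
parameters `η`, where `F(u) = F∞ ∏ sin (u + ξ n) / sin (u + conj (ξ n))` and
`S(u) = ∏ sin (u + η j) / sin (u + conj (η j))`. -/
structure TrigBetheData (N K : ℕ) where
  Finf : ℂ
  xi : Fin N → ℂ
  eta : Fin K → ℂ
  norm_Finf : ‖Finf‖ = 1
  Finf_ne_one : Finf ≠ 1
  xi_im_pos : ∀ n, 0 < (xi n).im
  eta_im_pos : ∀ j, 0 < (eta j).im
  xi_strip : ∀ n, -(Real.pi / 2) < (xi n).re ∧ (xi n).re ≤ Real.pi / 2
  eta_strip : ∀ j, -(Real.pi / 2) < (eta j).re ∧ (eta j).re ≤ Real.pi / 2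
  /-- `{η} = {-conj η}`, counted with multiplicities. -/
  eta_symm : Multiset.map eta Finset.univ.val =
    Multiset.map (fun j => -conj (eta j)) Finset.univ.val

namespace TrigBetheData

noncomputable section

/-- The trigonometric Baxter polynomial `Q(u | v) = ∏ sin (u - v m)`. -/
def baxterQ {M : ℕ} (v : Fin M → ℂ) (u : ℂ) : ℂ := ∏ m, Complex.sin (u - v m)

variable {N K : ℕ}

/-- `α(u) = F∞ ∏ sin (u + ξ n)`. -/
def alpha (d : TrigBetheData N K) (u : ℂ) : ℂ := d.Finf * ∏ n, Complex.sin (u + d.xi n)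

/-- `δ(u) = (-1) ^ (K + 1) ∏ sin (u + conj (ξ n))`. -/
def delta (d : TrigBetheData N K) (u : ℂ) : ℂ :=
  (-1) ^ (K + 1) * ∏ n, Complex.sin (u + conj (d.xi n))

/-- `𝒬(u | v) = α(u) ∏ Q(u + η k | v) + δ(u) ∏ Q(u + conj (η k) | v)`. -/
def calQ (d : TrigBetheData N K) {M : ℕ} (v : Fin M → ℂ) (u : ℂ) : ℂ :=
  d.alpha u * ∏ k, baxterQ v (u + d.eta k) + d.delta u * ∏ k, baxterQ v (u + conj (d.eta k))

/-- The strong generalized Bethe equations: the function `𝒬(u | v) / Q(u | v)`, defined off the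
zeros of `Q(u | v)`, is (extends to) an entire function of `u`. -/
def IsStrongSolution (d : TrigBetheData N K) {M : ℕ} (v : Fin M → ℂ) : Prop :=
  ∃ g : ℂ → ℂ, Differentiable ℂ g ∧ ∀ u, baxterQ v u ≠ 0 → g u = d.calQ v u / baxterQ v u

/-- Two root vectors are the same solution if they agree up to a permutation of the roots and up
to shifts of the roots by integer multiples of the period `π`. -/
def SameRoots {M : ℕ} (v w : Fin M → ℂ) : Prop :=
  ∃ σ : Equiv.Perm (Fin M), ∀ i, ∃ k : ℤ, w i = v (σ i) + k * (Real.pi : ℂ)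

theorem sameRoots_equivalence (M : ℕ) : Equivalence (SameRoots (M := M)) where
  refl v := ⟨1, fun i => ⟨0, by simp⟩⟩
  symm := by
    rintro v w ⟨σ, h⟩
    refine ⟨σ⁻¹, fun i => ?_⟩
    obtain ⟨k, hk⟩ := h (σ⁻¹ i)
    refine ⟨-k, ?_⟩
    rw [hk]
    simp
  trans := by
    rintro u v w ⟨σ, h⟩ ⟨τ, h'⟩
    refine ⟨σ * τ, fun i => ?_⟩
    obtain ⟨k, hk⟩ := h' i
    obtain ⟨l, hl⟩ := h (τ i)
    refine ⟨k + l, ?_⟩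
    rw [hk, hl, Equiv.Perm.mul_apply]
    push_cast
    ring

/-- The solutions `v ∈ ℂ^M` of the strong equations, identified by `SameRoots`. -/
def solutionSetoid (d : TrigBetheData N K) (M : ℕ) :
    Setoid {v : Fin M → ℂ // d.IsStrongSolution v} :=
  Setoid.comap Subtype.val ⟨SameRoots, sameRoots_equivalence M⟩

/-- The distinct solutions of the strong trigonometric generalized Bethe equations for `M`
roots. -/
def DistinctSolution (d : TrigBetheData N K) (M : ℕ) : Type :=
  Quotient (d.solutionSetoid M)

end

end TrigBetheData

/-- `C_M^{(K,N)} = N / (K M + N) * binom (K M + N) M`. -/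
def betheNumber (K N M : ℕ) : ℚ :=
  (N : ℚ) / ((K : ℚ) * M + N) * ((K * M + N).choose M : ℚ)

/-- The Fuss-Catalan numbers `1 / ((K - 1) M + 1) * binom (K M) M`. -/
def fussCatalan (K M : ℕ) : ℚ :=
  1 / (((K : ℚ) - 1) * M + 1) * ((K * M).choose M : ℚ)

/-! Compare the moduli of the two terms of `calQ` at the roots with largest and smallest imaginary
part: a root off the real axis would make them unequal, so every root is real
(`im_eq_zero_of_calQ_eq_zero`). On the real axis `calQ` is a nonvanishing factor times `exp (i (c -
Φ)) - 1`, where the phase `Φ = totalPhase w` has positive derivative (`calQ_ofReal`). Its real zeros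
are therefore simple, and the strong equations say exactly that the roots are distinct mod `π` and
that `Φ (w j) = c + 2π n j` with integers `n j` (`isStrongSolution_ofReal_iff`).

For given `n j` this real system has exactly one solution, by monotonicity
(`exists_solution_of_monotone`, `solution_unique_of_monotone`). Put `L = K M + N`. Since `Φ (x + π)
= Φ x + 2π L`, sorted roots extended by `u (i + M) = u i + π` correspond to strictly increasing
integer sequences with `n (i + M) = n i + L`. Starting the root sequence at another index lowers `Φ`
by a multiple of `2π K`, so the solutions are the orbits of `n ↦ n (· + k) - K k`.

The sum of `n` over a period grows by `k N` under this action, and by `k L` under the plain index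
shift, whose orbits are the `M`-subsets of `ℤ/L`. Counting the sequences with sum in `[0, N L)` in
both ways gives `(number of solutions) * L = N * binom L M`.

For the generating functions, the Pascal-type recursion `betheNumber_succ_succ` yields `B_a * B_b =
B_{a+b}`, hence `B_N = B_1 ^ N`. -/

/-! ### Arithmetic of the Bethe numbers and their generating series. -/

theorem betheNumber_eq_choose_pred {K M : ℕ} (N : ℕ) (hM : 0 < M) (hK : 0 < K) :
    betheNumber K N M = (N : ℚ) / M * ((K * M + N - 1).choose (M - 1) : ℚ) := by
  obtain ⟨m, rfl⟩ : ∃ m, M = m + 1 := ⟨M - 1, by omega⟩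
  obtain ⟨t, ht⟩ : ∃ t, K * (m + 1) + N = t + 1 :=
    ⟨K * (m + 1) + N - 1, by have := Nat.mul_pos hK hM; omega⟩
  have h1 := Nat.add_one_mul_choose_eq t m
  have h2 : ((K : ℚ) * ((m + 1 : ℕ) : ℚ) + N) = t + 1 := by exact_mod_cast ht
  have h3 : ((t : ℚ) + 1) * (t.choose m : ℚ) = ((t + 1).choose (m + 1) : ℚ) * (m + 1) := by
    exact_mod_cast h1
  unfold betheNumber
  rw [h2, ht]
  simp only [Nat.add_sub_cancel]
  push_cast
  have h4 : (t : ℚ) + 1 ≠ 0 := by positivity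
  have h5 : (m : ℚ) + 1 ≠ 0 := by positivity
  field_simp
  linear_combination -(N : ℚ) * h3

theorem betheNumber_one_eq_fussCatalan {K : ℕ} (hK : 0 < K) (M : ℕ) :
    betheNumber K 1 M = fussCatalan K M := by
  obtain ⟨k, rfl⟩ : ∃ k, K = k + 1 := ⟨K - 1, by omega⟩
  have h1 := Nat.choose_mul_succ_eq ((k + 1) * M) M
  have h2 : (k + 1) * M + 1 - M = k * M + 1 := by
    have : (k + 1) * M = k * M + M := by ring
    omega
  rw [h2] at h1
  have h3 : (((k + 1) * M).choose M : ℚ) * (((k + 1) * M : ℚ) + 1) =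
      (((k + 1) * M + 1).choose M : ℚ) * ((k * M : ℚ) + 1) := by exact_mod_cast h1
  unfold betheNumber fussCatalan
  push_cast
  have h4 : ((k : ℚ) + 1) * M + 1 ≠ 0 := by positivity
  have h5 : (k : ℚ) * M + 1 ≠ 0 := by positivity
  have h6 : ((k : ℚ) + 1 - 1) * M + 1 = k * M + 1 := by ring
  rw [h6]
  field_simp
  linear_combination -h3

theorem betheNumber_zero_right (K : ℕ) {N : ℕ} (hN : 0 < N) : betheNumber K N 0 = 1 := by
  have : (N : ℚ) ≠ 0 := by positivity
  simp [betheNumber, this]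

/-- This is the coefficient form of `B = 1 + t B ^ K` multiplied by `B ^ N`, where `B` is the
Fuss-Catalan series. -/
theorem betheNumber_succ_succ {K : ℕ} (hK : 0 < K) (N M : ℕ) :
    betheNumber K (N + 1) (M + 1) = betheNumber K N (M + 1) + betheNumber K (N + K) M := by
  rw [betheNumber_eq_choose_pred _ M.succ_pos hK, betheNumber_eq_choose_pred _ M.succ_pos hK]
  obtain ⟨t, ht⟩ : ∃ t, K * (M + 1) + N = t + 1 :=
    ⟨K * (M + 1) + N - 1, by have := Nat.mul_pos hK (Nat.add_one_pos M); omega⟩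
  have hle : M ≤ t + 1 := by nlinarith [Nat.le_mul_of_pos_left (M + 1) hK]
  have e1 : K * (M + 1) + (N + 1) - 1 = t + 1 := by omega
  have e2 : K * (M + 1) + N - 1 = t := by omega
  have e3 : K * M + (N + K) = t + 1 := by rw [← ht]; ring
  have e4 : (K : ℚ) * M + ((N + K : ℕ) : ℚ) = t + 1 := by exact_mod_cast e3
  unfold betheNumber
  rw [Nat.succ_eq_add_one, e1, e2, e3, e4]
  have h1 := Nat.choose_mul_succ_eq t M
  have h3 : (t.choose M : ℚ) * ((t : ℚ) + 1) = ((t + 1).choose M : ℚ) * (t + 1 - M) := by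
    have := congrArg (Nat.cast : ℕ → ℚ) h1
    push_cast [Nat.cast_sub hle] at this
    exact this
  have h4 : (t : ℚ) + 1 ≠ 0 := by positivity
  have h5 : (M : ℚ) + 1 ≠ 0 := by positivity
  have h6 : (K : ℚ) * (M + 1) + N = t + 1 := by exact_mod_cast ht
  simp only [Nat.add_sub_cancel]
  push_cast
  field_simp
  linear_combination (-(N : ℚ)) * h3 - ((t + 1).choose M : ℚ) * h6

/-- The generating series of the Bethe numbers, with value `1` at `N = 0`. -/
noncomputable def betheSeries (K N : ℕ) : PowerSeries ℚ :=
  -- `betheNumber K 0 0` is `0 / 0 = 0`, whereas the zeroth power must be the series `1`.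
  PowerSeries.mk fun M => if M = 0 then 1 else betheNumber K N M

theorem betheSeries_eq_mk (K : ℕ) {N : ℕ} (hN : 0 < N) :
    betheSeries K N = PowerSeries.mk (betheNumber K N) := by
  ext M
  rcases eq_or_ne M 0 with rfl | h <;> simp [betheSeries, betheNumber_zero_right, *]

theorem betheSeries_zero (K : ℕ) : betheSeries K 0 = 1 := by
  ext M
  simp [betheSeries, PowerSeries.coeff_one, betheNumber]

theorem betheSeries_succ {K : ℕ} (hK : 0 < K) (N : ℕ) :
    betheSeries K (N + 1) = betheSeries K N + PowerSeries.X * betheSeries K (N + K) := by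
  rw [betheSeries_eq_mk K (N := N + K) (by omega)]
  ext M
  cases M with
  | zero => simp [betheSeries]
  | succ M =>
    rw [map_add, PowerSeries.coeff_succ_X_mul]
    simp [betheSeries, betheNumber_succ_succ hK]

/-- The recursion lowers either `a` or the degree of the coefficient. In the second case `a` grows
to `a + K`, so the hypothesis on the degree is needed for all `a`. -/
theorem betheSeries_mul {K : ℕ} (hK : 0 < K) (a b : ℕ) :
    betheSeries K a * betheSeries K b = betheSeries K (a + b) := by
  suffices h : ∀ M a, PowerSeries.coeff M (betheSeries K a * betheSeries K b) =
      PowerSeries.coeff M (betheSeries K (a + b)) from PowerSeries.ext fun M => h M a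
  intro M
  induction M with
  | zero => intro a; simp [PowerSeries.coeff_mul, betheSeries]
  | succ M ihM =>
    intro a
    induction a with
    | zero => simp [betheSeries_zero]
    | succ a iha =>
      rw [betheSeries_succ hK, add_right_comm a 1 b, betheSeries_succ hK, add_mul, map_add,
        map_add, iha, mul_assoc, PowerSeries.coeff_succ_X_mul, PowerSeries.coeff_succ_X_mul, ihM,
        add_right_comm a K b]

theorem betheSeries_eq_pow {K : ℕ} (hK : 0 < K) (N : ℕ) :
    betheSeries K N = betheSeries K 1 ^ N := by
  induction N with
  | zero => rw [betheSeries_zero, pow_zero]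
  | succ N ih => rw [pow_succ, ← ih, betheSeries_mul hK]

/-! ### Periodic strictly increasing sequences -/

/-- Both sequences are order isomorphisms of `ℤ` onto the same set; they differ by an order
automorphism of `ℤ`, which commutes with the successor and so is a translation. -/
theorem shift_of_range_eq {α : Type*} [LinearOrder α] {v w : ℤ → α} (hv : StrictMono v)
    (hw : StrictMono w) (h : Set.range v = Set.range w) : ∃ k : ℤ, ∀ i, w i = v (i + k) := by
  let e : ℤ ≃o ℤ :=
    ((hw.orderIso w).trans (OrderIso.setCongr _ _ h.symm)).trans (hv.orderIso v).symm
  have he : ∀ i, v (e i) = w i := fun i => by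
    have : (hv.orderIso v) (e i) = OrderIso.setCongr _ _ h.symm (hw.orderIso w i) := by
      simp [e]
    exact congrArg Subtype.val this
  have hsucc : ∀ i, e (i + 1) = e i + 1 := fun i => by
    simpa [Order.succ_eq_add_one] using e.map_succ i
  refine ⟨e 0, fun i => ?_⟩
  rw [← he]
  congr 1
  induction i using Int.induction_on with
  | zero => simp
  | succ i ih => rw [hsucc, ih]; ring
  | pred i ih =>
    have := hsucc (-(i : ℤ) - 1)
    rw [sub_add_cancel, ih] at this
    linarith

theorem periodic_add_mul {G : Type*} [AddCommGroup G] {v : ℤ → G} {M : ℕ} {p : G}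
    (h : ∀ i, v (i + M) = v i + p) (i k : ℤ) : v (i + k * M) = v i + k • p := by
  induction k using Int.induction_on with
  | zero => simp
  | succ k ih => rw [add_mul, one_mul, ← add_assoc, h, ih, add_zsmul, one_zsmul, add_assoc]
  | pred k ih =>
    have := h (i + (-(k : ℤ) - 1) * M)
    rw [show i + (-(k : ℤ) - 1) * M + M = i + -(k : ℤ) * M by ring, ih] at this
    rw [sub_zsmul, one_zsmul, ← add_assoc, this, add_neg_cancel_right]

theorem periodic_emod {G : Type*} [AddCommGroup G] {v : ℤ → G} {M : ℕ} {p : G}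
    (h : ∀ i, v (i + M) = v i + p) (i : ℤ) : v i = v (i % M) + (i / M) • p := by
  rw [← periodic_add_mul h]
  congr 1
  rw [mul_comm]
  exact (Int.emod_add_mul_ediv i M).symm

theorem sum_shift {G : Type*} [AddCommGroup G] {g : ℤ → G} {M : ℕ} {p : G}
    (h : ∀ i, g (i + M) = g i + p) (k : ℤ) :
    ∑ m : Fin M, g ((m : ℤ) + k) = ∑ m : Fin M, g m + k • p := by
  have step : ∀ k : ℤ, ∑ m : Fin M, g ((m : ℤ) + (k + 1)) = ∑ m : Fin M, g ((m : ℤ) + k) + p := by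
    intro k
    have h1 := Finset.sum_range_succ (fun m : ℕ => g ((m : ℤ) + k)) M
    rw [Finset.sum_range_succ'] at h1
    have h2 : g ((M : ℤ) + k) = g (((0 : ℕ) : ℤ) + k) + p := by
      rw [add_comm, h]; simp
    rw [h2, add_comm (g _) p, ← add_assoc] at h1
    have h3 := add_right_cancel h1
    rw [Fin.sum_univ_eq_sum_range (fun m : ℕ => g ((m : ℤ) + (k + 1))) M,
      Fin.sum_univ_eq_sum_range (fun m : ℕ => g ((m : ℤ) + k)) M, ← h3]
    refine Finset.sum_congr rfl fun m _ => ?_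
    push_cast
    congr 1
    ring
  induction k using Int.induction_on with
  | zero => simp
  | succ k ih => rw [step, ih, add_zsmul, one_zsmul, add_assoc]
  | pred k ih =>
    have := step (-(k : ℤ) - 1)
    rw [sub_add_cancel, ih] at this
    rw [sub_zsmul, one_zsmul, ← add_assoc, this, add_neg_cancel_right]

/-- The extension of a finite sequence to a sequence over `ℤ` with `v (i + M) = v i + p`. -/
def periodicExtension {G : Type*} [AddCommGroup G] {M : ℕ} [NeZero M] (p : G) (w : Fin M → G)
    (i : ℤ) : G :=
  w (Fin.ofNat M (i % M).toNat) + (i / M) • p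

section periodicExtension

variable {G : Type*} [AddCommGroup G] {M : ℕ} [NeZero M]

theorem natCast_pos_of_neZero {M : ℕ} [NeZero M] : (0 : ℤ) < M := by
  exact_mod_cast Nat.pos_of_ne_zero (NeZero.ne M)

theorem periodicExtension_add (p : G) (w : Fin M → G) (i : ℤ) :
    periodicExtension p w (i + M) = periodicExtension p w i + p := by
  have h : (M : ℤ) ≠ 0 := natCast_pos_of_neZero.ne'
  simp only [periodicExtension, Int.add_emod_right, Int.add_ediv_of_dvd_right (dvd_refl (M : ℤ)),
    Int.ediv_self h, add_zsmul, one_zsmul, add_assoc]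

theorem periodicExtension_coe (p : G) (w : Fin M → G) (i : Fin M) :
    periodicExtension p w i = w i := by
  have h1 : ((i : ℕ) : ℤ) % M = (i : ℕ) :=
    Int.emod_eq_of_lt (by positivity) (by exact_mod_cast i.2)
  have h2 : ((i : ℕ) : ℤ) / M = 0 :=
    Int.ediv_eq_zero_of_lt (by positivity) (by exact_mod_cast i.2)
  simp [periodicExtension, h1, h2]

theorem mem_range_of_periodic {v : ℤ → G} {p : G} (hv : ∀ i, v (i + M) = v i + p) (x : G) :
    x ∈ Set.range v ↔ ∃ (i : Fin M) (k : ℤ), x = v i + k • p := by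
  constructor
  · rintro ⟨i, rfl⟩
    have h0 := Int.emod_nonneg i (natCast_pos_of_neZero (M := M)).ne'
    have h1 := Int.emod_lt_of_pos i (natCast_pos_of_neZero (M := M))
    refine ⟨⟨(i % M).toNat, by omega⟩, i / M, ?_⟩
    rw [Int.toNat_of_nonneg h0]
    exact periodic_emod hv i
  · rintro ⟨i, k, rfl⟩
    exact ⟨_, periodic_add_mul hv i k⟩

/-- A finite sequence with values distinct modulo `p` has, up to the order of its values and to
multiples of `p`, a strictly increasing periodic extension. -/
theorem exists_strictMono_periodic [LinearOrder G] [IsOrderedAddMonoid G] [Archimedean G] {p : G}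
    (hp : 0 < p) (w : Fin M → G) (hw : ∀ i j, (∃ k : ℤ, w i = w j + k • p) → i = j) :
    ∃ v : ℤ → G, StrictMono v ∧ (∀ i, v (i + M) = v i + p) ∧
      ∀ x, x ∈ Set.range v ↔ ∃ (i : Fin M) (k : ℤ), x = w i + k • p := by
  let r : Fin M → G := fun i => toIcoMod hp 0 (w i)
  have hr' : ∀ i, r i = w i - toIcoDiv hp 0 (w i) • p := fun i => rfl
  have hr : ∀ i, w i = r i + toIcoDiv hp 0 (w i) • p := fun i =>
    (toIcoMod_add_toIcoDiv_zsmul hp 0 (w i)).symm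
  have hrinj : Function.Injective r := fun i j hij => hw i j
    ⟨toIcoDiv hp 0 (w i) - toIcoDiv hp 0 (w j), by
      rw [hr', hr', sub_eq_iff_eq_add] at hij
      refine hij.trans ?_
      rw [sub_zsmul]
      abel⟩
  let σ := Tuple.sort r
  have hmono : StrictMono (r ∘ σ) :=
    (Tuple.monotone_sort r).strictMono_of_injective (hrinj.comp σ.injective)
  let v := periodicExtension p (r ∘ σ)
  have hper : ∀ i, v (i + M) = v i + p := periodicExtension_add p _
  refine ⟨v, ?_, hper, fun x => ?_⟩
  · intro i j hij
    have hM := natCast_pos_of_neZero (M := M)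
    have hi0 := Int.emod_nonneg i hM.ne'
    have hi1 := Int.emod_lt_of_pos i hM
    have hj0 := Int.emod_nonneg j hM.ne'
    have hj1 := Int.emod_lt_of_pos j hM
    have hi2 := Int.emod_add_mul_ediv i M
    have hj2 := Int.emod_add_mul_ediv j M
    have hdiv : i / M ≤ j / M := Int.ediv_le_ediv hM hij.le
    rcases hdiv.eq_or_lt with h | h
    · have hlt : (Fin.ofNat M (i % M).toNat) < Fin.ofNat M (j % M).toNat := by
        rw [Fin.lt_def, Fin.val_ofNat, Fin.val_ofNat, Nat.mod_eq_of_lt (by omega),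
          Nat.mod_eq_of_lt (by omega)]
        rw [h] at hi2
        omega
      show _ + _ < _ + _
      rw [h]
      exact add_lt_add_left (hmono hlt) _
    · have h1 : (i / M + 1) • p ≤ (j / M) • p := zsmul_le_zsmul_left hp.le (by omega)
      rw [add_zsmul, one_zsmul] at h1
      have h2 := (toIcoMod_mem_Ico hp 0 (w (σ (Fin.ofNat M (i % M).toNat)))).2
      have h3 := (toIcoMod_mem_Ico hp 0 (w (σ (Fin.ofNat M (j % M).toNat)))).1
      rw [zero_add] at h2
      calc v i = r (σ (Fin.ofNat M (i % M).toNat)) + (i / M) • p := rfl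
        _ < p + (i / M) • p := add_lt_add_left h2 _
        _ = (i / M) • p + p := add_comm _ _
        _ ≤ (j / M) • p := h1
        _ ≤ r (σ (Fin.ofNat M (j % M).toNat)) + (j / M) • p := le_add_of_nonneg_left h3
        _ = v j := rfl
  · rw [mem_range_of_periodic hper]
    constructor
    · rintro ⟨i, k, rfl⟩
      refine ⟨σ i, k - toIcoDiv hp 0 (w (σ i)), ?_⟩
      rw [show v i = r (σ i) from periodicExtension_coe p _ i, sub_zsmul, hr']
      abel
    · rintro ⟨i, k, rfl⟩
      refine ⟨σ.symm i, toIcoDiv hp 0 (w i) + k, ?_⟩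
      rw [show v (σ.symm i) = r (σ (σ.symm i)) from periodicExtension_coe p _ _,
        Equiv.apply_symm_apply, add_zsmul, ← add_assoc, ← hr]

theorem eq_of_periodic_of_eq_on {v w : ℤ → G} {p : G} (hv : ∀ i, v (i + M) = v i + p)
    (hw : ∀ i, w (i + M) = w i + p) (h : ∀ i : Fin M, v i = w i) : v = w := by
  funext i
  have h0 := Int.emod_nonneg i (natCast_pos_of_neZero (M := M)).ne'
  have h1 := Int.emod_lt_of_pos i (natCast_pos_of_neZero (M := M))
  rw [periodic_emod hv i, periodic_emod hw i]
  have := h ⟨(i % M).toNat, by omega⟩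
  rw [Int.toNat_of_nonneg h0] at this
  rw [this]

omit [NeZero M] in
/-- Distinct entries of a strictly increasing periodic sequence in one period are distinct modulo
the period. -/
theorem eq_of_strictMono_periodic [LinearOrder G] {v : ℤ → G} {p : G} (hm : StrictMono v)
    (hv : ∀ i, v (i + M) = v i + p) (i j : Fin M) (h : ∃ k : ℤ, v i = v j + k • p) : i = j := by
  obtain ⟨k, hk⟩ := h
  rw [← periodic_add_mul hv] at hk
  have h1 := congrArg (· % (M : ℤ)) (hm.injective hk)
  simp only [Int.add_mul_emod_self_right] at h1
  rw [Int.emod_eq_of_lt (by positivity) (by exact_mod_cast i.2),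
    Int.emod_eq_of_lt (by positivity) (by exact_mod_cast j.2)] at h1
  exact Fin.ext (by exact_mod_cast h1)

end periodicExtension

/-! ### Counting by transversals -/

/-- The fibres of `f` are the orbits of `e`, along which `h` runs through a residue class mod `a`;
division with remainder picks one point of each orbit. -/
theorem nonempty_transversal_equiv {X Y : Type*} {a : ℤ} (ha : 0 < a) (h : X → ℤ) (e : ℤ → X → X)
    (he : ∀ k x, h (e k x) = h x + k * a) (h0 : ∀ x, e 0 x = x) (f : X → Y)
    (hf : Function.Surjective f) (hfe : ∀ x y, f x = f y ↔ ∃ k, y = e k x) :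
    Nonempty ({x // 0 ≤ h x ∧ h x < a} ≃ Y) := by
  refine ⟨Equiv.ofBijective (fun x => f x.1) ⟨?_, ?_⟩⟩
  · rintro ⟨x, hx⟩ ⟨y, hy⟩ hxy
    obtain ⟨k, hk⟩ := (hfe x y).1 hxy
    have h1 := he k x
    rw [← hk] at h1
    have h2 : k < 1 := by
      by_contra! hc
      nlinarith
    have h3 : -1 < k := by
      by_contra! hc
      nlinarith
    obtain rfl : k = 0 := by omega
    rw [h0] at hk
    exact Subtype.ext hk.symm
  · intro y
    obtain ⟨x, rfl⟩ := hf y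
    have h1 := Int.emod_nonneg (h x) ha.ne'
    have h2 := Int.emod_lt_of_pos (h x) ha
    have h3 := Int.emod_add_mul_ediv (h x) a
    have h4 : h (e (-(h x / a)) x) = h x % a := by rw [he]; linarith
    exact ⟨⟨e (-(h x / a)) x, by omega⟩, ((hfe _ _).2 ⟨_, rfl⟩).symm⟩

/-- A window of length `a * b` is tiled by `b` translates of a window of length `a`. -/
theorem nonempty_window_prod_equiv {X : Type*} {a : ℕ} (ha : 0 < a) (b : ℕ) (h : X → ℤ) (e : ℤ → X → X)
    (he : ∀ k x, h (e k x) = h x + k * a) (h0 : ∀ x, e 0 x = x)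
    (hadd : ∀ k l x, e k (e l x) = e (k + l) x) :
    Nonempty ({x // 0 ≤ h x ∧ h x < a} × Fin b ≃ {x // 0 ≤ h x ∧ h x < a * b}) := by
  have ha' : (0 : ℤ) < a := by exact_mod_cast ha
  refine ⟨Equiv.ofBijective (fun x => ⟨e (x.2 : ℕ) x.1.1, ?_, ?_⟩) ⟨?_, ?_⟩⟩
  · rw [he]
    have := x.1.2.1
    positivity
  · rw [he]
    have h1 := x.1.2.2
    have h2 : ((x.2 : ℕ) : ℤ) + 1 ≤ b := by exact_mod_cast x.2.2
    nlinarith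
  · rintro ⟨⟨x, hx⟩, k⟩ ⟨⟨y, hy⟩, l⟩ hxy
    have hxy : e (k : ℕ) x = e (l : ℕ) y := congrArg Subtype.val hxy
    have h1 := congrArg h hxy
    rw [he, he] at h1
    have hkl : ((k : ℕ) : ℤ) = (l : ℕ) := by
      have h2 : ((k : ℕ) : ℤ) < (l : ℕ) + 1 := by
        by_contra! hc
        nlinarith
      have h3 : ((l : ℕ) : ℤ) < (k : ℕ) + 1 := by
        by_contra! hc
        nlinarith
      omega
    have h2 := congrArg (e (-(k : ℕ))) hxy
    rw [hadd, hkl, hadd, neg_add_cancel, h0, h0] at h2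
    exact Prod.ext (Subtype.ext h2) (Fin.ext (by exact_mod_cast hkl))
  · rintro ⟨y, hy0, hy1⟩
    have h1 := Int.emod_nonneg (h y) ha'.ne'
    have h2 := Int.emod_lt_of_pos (h y) ha'
    have h3 := Int.emod_add_mul_ediv (h y) a
    have h4 : 0 ≤ h y / a := Int.ediv_nonneg hy0 ha'.le
    have h5 : h y / a < b := Int.ediv_lt_of_lt_mul ha' (by linarith)
    refine ⟨⟨⟨e (-(h y / a)) y, ?_⟩, ⟨(h y / a).toNat, by omega⟩⟩, Subtype.ext ?_⟩
    · rw [he]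
      constructor <;> linarith
    · show e ((h y / a).toNat : ℕ) (e _ y) = y
      rw [Int.toNat_of_nonneg h4, hadd, add_neg_cancel, h0]

/-! ### Quantum number sequences, their shifts and the count of orbits. -/

/-- Strictly increasing integer sequences with `n (i + M) = n i + L`. -/
@[ext]
structure PeriodicSeq (M L : ℕ) where
  toFun : ℤ → ℤ
  strictMono : StrictMono toFun
  periodic : ∀ i, toFun (i + M) = toFun i + L

namespace PeriodicSeq

variable {M L : ℕ}

/-- Shift of the index by `k`, together with a translation by `-D k`. -/
def shift (D : ℤ) (k : ℤ) (n : PeriodicSeq M L) : PeriodicSeq M L :=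
  ⟨fun i => n.toFun (i + k) - D * k,
    fun _ _ h => sub_lt_sub_right (n.2 (by linarith)) _,
    fun i => by show n.1 _ - _ = n.1 _ - _ + _; rw [add_right_comm, n.3]; ring⟩

def sum (n : PeriodicSeq M L) : ℤ := ∑ m : Fin M, n.1 m

theorem shift_zero (D : ℤ) (n : PeriodicSeq M L) : shift D 0 n = n :=
  PeriodicSeq.ext (by funext i; simp [shift])

theorem shift_shift (D k l : ℤ) (n : PeriodicSeq M L) :
    shift D k (shift D l n) = shift D (k + l) n :=
  PeriodicSeq.ext (by
    funext i
    simp only [shift]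
    rw [add_assoc i k l]
    ring)

/-- For `L = K M + N` the increment is `k N` when `D = K` and `k L` when `D = 0`. The orbit count
rests on comparing these two. -/
theorem sum_shift (D k : ℤ) (n : PeriodicSeq M L) :
    (shift D k n).sum = n.sum + k * (L - D * M) := by
  have := _root_.sum_shift n.3 k
  simp only [sum, shift, Finset.sum_sub_distrib, this]
  simp
  ring

/-- The residues modulo `L` of the values. -/
def residues (n : PeriodicSeq M L) : Finset ℤ := Finset.univ.image fun i : Fin M => n.1 i % L

theorem mem_residues [NeZero M] (hL : 0 < L) (n : PeriodicSeq M L) (x : ℤ) :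
    x ∈ n.residues ↔ x ∈ Set.range n.1 ∧ 0 ≤ x ∧ x < L := by
  have hL' : (0 : ℤ) < L := by exact_mod_cast hL
  rw [mem_range_of_periodic n.3, residues, Finset.mem_image]
  constructor
  · rintro ⟨i, -, rfl⟩
    refine ⟨⟨i, -(n.1 i / L), ?_⟩, Int.emod_nonneg _ hL'.ne', Int.emod_lt_of_pos _ hL'⟩
    have := Int.emod_add_mul_ediv (n.1 i) L
    rw [smul_eq_mul]
    linarith
  · rintro ⟨⟨i, k, rfl⟩, h0, h1⟩
    refine ⟨i, Finset.mem_univ _, ?_⟩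
    rw [smul_eq_mul] at h0 h1 ⊢
    rw [← Int.add_mul_emod_self_right (n.1 i) k L, Int.emod_eq_of_lt h0 h1]

theorem residues_mem_powersetCard [NeZero M] (hL : 0 < L) (n : PeriodicSeq M L) :
    n.residues ∈ (Finset.Ico (0 : ℤ) L).powersetCard M := by
  rw [Finset.mem_powersetCard]
  constructor
  · intro x hx
    exact Finset.mem_Ico.2 ((mem_residues hL n x).1 hx).2
  · rw [residues, Finset.card_image_of_injective _ _, Finset.card_univ, Fintype.card_fin]
    intro i j hij
    refine eq_of_strictMono_periodic n.2 n.3 i j ⟨n.1 i / L - n.1 j / L, ?_⟩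
    have h1 := Int.emod_add_mul_ediv (n.1 i) L
    have h2 := Int.emod_add_mul_ediv (n.1 j) L
    have h3 : n.1 i % L = n.1 j % L := hij
    rw [smul_eq_mul]
    linarith

theorem range_subset_of_residues_eq [NeZero M] {n n' : PeriodicSeq M L}
    (h : n.residues = n'.residues) : Set.range n.1 ⊆ Set.range n'.1 := by
  rintro _ ⟨i, rfl⟩
  obtain ⟨j, k, hk⟩ := (mem_range_of_periodic n.3 (n.1 i)).1 ⟨i, rfl⟩
  have h1 : n.1 j % L ∈ n'.residues := by
    rw [← h]
    exact Finset.mem_image_of_mem _ (Finset.mem_univ j)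
  obtain ⟨l, -, hl⟩ := Finset.mem_image.1 h1
  refine (mem_range_of_periodic n'.3 _).2 ⟨l, k + n.1 j / L - n'.1 l / L, ?_⟩
  have h2 := Int.emod_add_mul_ediv (n.1 j) L
  have h3 := Int.emod_add_mul_ediv (n'.1 l) L
  rw [hk, smul_eq_mul, smul_eq_mul]
  linarith

theorem residues_eq_iff [NeZero M] (hL : 0 < L) (n n' : PeriodicSeq M L) :
    n.residues = n'.residues ↔ ∃ k, n' = shift 0 k n := by
  constructor
  · intro h
    obtain ⟨k, hk⟩ := shift_of_range_eq n.2 n'.2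
      ((range_subset_of_residues_eq h).antisymm (range_subset_of_residues_eq h.symm))
    exact ⟨k, PeriodicSeq.ext (by funext i; simp [shift, hk])⟩
  · rintro ⟨k, rfl⟩
    have : Set.range (shift 0 k n).1 = Set.range n.1 := by
      have h1 : (shift 0 k n).1 = n.1 ∘ (Equiv.addRight k) := by
        funext i; simp [shift]
      rw [h1, Set.range_comp, (Equiv.addRight k).range_eq_univ, Set.image_univ]
    ext x
    rw [mem_residues hL, mem_residues hL, this]

theorem exists_residues_eq [NeZero M] (hL : 0 < L) {S : Finset ℤ}
    (hS : S ∈ (Finset.Ico (0 : ℤ) L).powersetCard M) : ∃ n : PeriodicSeq M L, n.residues = S := by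
  have hL' : (0 : ℤ) < L := by exact_mod_cast hL
  obtain ⟨hsub, hcard⟩ := Finset.mem_powersetCard.1 hS
  let w := S.orderEmbOfFin hcard
  have hmem : ∀ i, 0 ≤ w i ∧ w i < L := fun i =>
    Finset.mem_Ico.1 (hsub (S.orderEmbOfFin_mem hcard i))
  have hmod : ∀ i, w i % L = w i := fun i => Int.emod_eq_of_lt (hmem i).1 (hmem i).2
  obtain ⟨v, hv, hper, hrange⟩ := exists_strictMono_periodic hL' w (by
    rintro i j ⟨k, hk⟩
    apply w.injective
    rw [← hmod i, hk, smul_eq_mul, Int.add_mul_emod_self_right, hmod])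
  refine ⟨⟨v, hv, hper⟩, ?_⟩
  ext x
  rw [mem_residues hL, hrange]
  constructor
  · rintro ⟨⟨i, k, rfl⟩, h0, h1⟩
    rw [smul_eq_mul] at h0 h1 ⊢
    rw [← Int.emod_eq_of_lt h0 h1, Int.add_mul_emod_self_right, hmod]
    exact S.orderEmbOfFin_mem hcard i
  · intro hx
    obtain ⟨i, rfl⟩ : x ∈ Set.range w := by
      rw [Finset.range_orderEmbOfFin]; exact hx
    exact ⟨⟨i, 0, by simp⟩, hmem i⟩

/-- The window is a transversal of the orbits under pure index shifts, and such an orbit is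
determined by its `M`-element set of residues mod `L`. -/
theorem card_sum_window [NeZero M] (hL : 0 < L) :
    Finite {n : PeriodicSeq M L // 0 ≤ n.sum ∧ n.sum < L} ∧
    Nat.card {n : PeriodicSeq M L // 0 ≤ n.sum ∧ n.sum < L} = L.choose M := by
  have hL' : (0 : ℤ) < L := by exact_mod_cast hL
  obtain ⟨e⟩ := nonempty_transversal_equiv (Y := (Finset.Ico (0 : ℤ) L).powersetCard M) hL'
    (sum (M := M) (L := L)) (shift 0)
    (fun k n => by rw [sum_shift]; ring) (shift_zero 0)
    (fun n => ⟨n.residues, residues_mem_powersetCard hL n⟩)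
    (fun S => by
      obtain ⟨n, hn⟩ := exists_residues_eq hL S.2
      exact ⟨n, Subtype.ext hn⟩)
    (fun n n' => by rw [Subtype.mk.injEq, residues_eq_iff hL])
  refine ⟨Finite.of_equiv _ e.symm, ?_⟩
  rw [Nat.card_congr e, Nat.card_eq_fintype_card, Fintype.card_coe, Finset.card_powersetCard]
  simp

end PeriodicSeq

/-- The orbits of periodic sequences under the shift by `K` are counted by Bethe numbers. -/
theorem card_of_shift_orbits {K N M L : ℕ} [NeZero M] (hN : 0 < N)
    (hL : K * M + N = L) {Y : Type*} (f : PeriodicSeq M L → Y) (hf : Function.Surjective f)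
    (hfe : ∀ n n', f n = f n' ↔ ∃ k : ℤ, n' = PeriodicSeq.shift K k n) :
    Finite Y ∧ (Nat.card Y : ℚ) = betheNumber K N M := by
  have hN' : (0 : ℤ) < N := by exact_mod_cast hN
  have hLpos : 0 < L := by omega
  have hsum : ∀ k (n : PeriodicSeq M L), (n.shift K k).sum = n.sum + k * N := fun k n => by
    
    have : (L : ℤ) = K * M + N := by exact_mod_cast hL.symm
    rw [PeriodicSeq.sum_shift]
    linear_combination k * this
  obtain ⟨e⟩ := nonempty_transversal_equiv hN' PeriodicSeq.sum (PeriodicSeq.shift K) hsum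
    (PeriodicSeq.shift_zero K) f hf hfe
  obtain ⟨e1⟩ := nonempty_window_prod_equiv hN L PeriodicSeq.sum (PeriodicSeq.shift (M := M) (L := L) K) hsum
    (PeriodicSeq.shift_zero K) (PeriodicSeq.shift_shift K)
  obtain ⟨e2⟩ := nonempty_window_prod_equiv hLpos N PeriodicSeq.sum (PeriodicSeq.shift (M := M) (L := L) 0)
    (fun k n => by rw [PeriodicSeq.sum_shift]; ring)
    (PeriodicSeq.shift_zero 0) (PeriodicSeq.shift_shift 0)
  rw [mul_comm (L : ℤ) N] at e2
  obtain ⟨hfin, hcard⟩ := PeriodicSeq.card_sum_window (M := M) hLpos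
  -- The window `[0, N L)` consists of `L` translates of `[0, N)`, which represents `Y`, under the
  -- shift by `K`, and of `N` translates of `[0, L)` under the pure index shift.
  let E := ((e.symm.prodCongr (Equiv.refl (Fin L))).trans e1).trans e2.symm
  have h1 : Nat.card Y * L = L.choose M * N := by
    have := Nat.card_congr E
    rwa [Nat.card_prod, Nat.card_prod, hcard, Nat.card_fin, Nat.card_fin] at this
  have : Finite (Y × Fin L) := Finite.of_equiv _ E.symm
  have : NeZero L := ⟨hLpos.ne'⟩
  refine ⟨Finite.of_surjective (Prod.fst : Y × Fin L → Y) Prod.fst_surjective, ?_⟩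
  have h2 : (Nat.card Y : ℚ) * (K * M + N) = (L.choose M : ℚ) * N := by
    have : (K : ℚ) * M + N = L := by exact_mod_cast hL
    rw [this]
    exact_mod_cast h1
  have h3 : (K : ℚ) * M + N ≠ 0 := by positivity
  rw [betheNumber, hL]
  field_simp
  linarith

/-! ### Monotone systems of real equations. -/

open Filter Topology in
/-- Existence for a system whose `j`-th equation is increasing in `v j` and decreasing in the other
unknowns: the supremum of all subsolutions is a solution. -/
theorem exists_solution_of_monotone {ι : Type*} [Fintype ι] {p q : ℝ → ℝ}
    (hp : Continuous p) (hq : Continuous q) (hpm : Monotone p) (hqm : Monotone q)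
    (hbot : ∀ B, ∃ x, p x ≤ B) (htop : ∀ B, ∃ x, B < p x) (b : ι → ℝ) :
    ∃ v : ι → ℝ, ∀ j, p (v j) + ∑ m, q (v j - v m) = b j := by
  classical
  rcases isEmpty_or_nonempty ι with hι | hι
  · exact ⟨fun _ => 0, fun j => hι.elim j⟩
  let S : Set (ι → ℝ) := {w | ∀ j, p (w j) + ∑ m, q (w j - w m) ≤ b j}
  obtain ⟨jmin, hjmin⟩ := Finite.exists_min b
  obtain ⟨jmax, hjmax⟩ := Finite.exists_max b
  -- At a constant vector all differences vanish and each sum is `∑ q 0`, so `x₀` gives a constant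
  -- subsolution. The point `x₁` will bound all subsolutions, tested at their largest entry, where
  -- all differences are nonnegative.
  obtain ⟨x₀, hx₀⟩ := hbot (b jmin - ∑ _m : ι, q 0)
  obtain ⟨x₁, hx₁⟩ := htop (b jmax - ∑ _m : ι, q 0)
  have hS : (fun _ => x₀) ∈ S := fun j => by
    have := hjmin j
    simp only [sub_self]
    linarith
  have hbd : ∀ w ∈ S, ∀ j, w j ≤ x₁ := by
    intro w hw j
    obtain ⟨i, hi⟩ := Finite.exists_max w
    refine (hi j).trans ?_
    by_contra! hlt
    have h1 : p x₁ ≤ p (w i) := hpm hlt.le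
    have h2 : ∑ _m : ι, q 0 ≤ ∑ m, q (w i - w m) :=
      Finset.sum_le_sum fun m _ => hqm (sub_nonneg.2 (hi m))
    have h3 := hw i
    have h4 := hjmax i
    linarith
  have hba : ∀ j, BddAbove ((fun w : ι → ℝ => w j) '' S) := fun j =>
    ⟨x₁, by rintro _ ⟨w, hw, rfl⟩; exact hbd w hw j⟩
  let v : ι → ℝ := fun j => sSup ((fun w : ι → ℝ => w j) '' S)
  have hle : ∀ w ∈ S, ∀ j, w j ≤ v j := fun w hw j => le_csSup (hba j) ⟨w, hw, rfl⟩
  -- the left-hand side of the `j`-th equation, with the unknown `v j` replaced by `x`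
  let g : ι → ℝ → ℝ := fun j x => p x + ∑ m, q (if m = j then 0 else x - v m)
  have hg : ∀ j, Continuous (g j) := fun j =>
    hp.add (continuous_finsetSum _ fun m _ => by
      by_cases h : m = j
      · simp only [h, if_true]; fun_prop
      · simp only [h, if_false]; fun_prop)
  have hgv : ∀ j, g j (v j) = p (v j) + ∑ m, q (v j - v m) := fun j => by
    simp only [g]
    congr 1
    refine Finset.sum_congr rfl fun m _ => ?_
    by_cases h : m = j
    · subst h; simp
    · simp [h]
  -- Replacing the other entries of a subsolution by the larger `v m` only lowers the left-hand
  -- side; the resulting closed condition on the `j`-th entry passes to the supremum.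
  have hvS : ∀ j, g j (v j) ≤ b j := by
    intro j
    have hcl : v j ∈ closure ((fun w : ι → ℝ => w j) '' S) :=
      csSup_mem_closure ⟨_, _, hS, rfl⟩ (hba j)
    have hsub : (fun w : ι → ℝ => w j) '' S ⊆ {x | g j x ≤ b j} := by
      rintro _ ⟨w, hw, rfl⟩
      refine le_trans ?_ (hw j)
      refine add_le_add le_rfl (Finset.sum_le_sum fun m _ => hqm ?_)
      by_cases h : m = j
      · subst h; simp
      · rw [if_neg h]; exact sub_le_sub_left (hle w hw m) _
    exact closure_minimal hsub (isClosed_le (hg j) continuous_const) hcl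
  refine ⟨v, fun j => ?_⟩
  rw [← hgv]
  refine (hvS j).antisymm ?_
  by_contra! hlt
  -- If equation `j` were strict, raising `v j` alone a little would keep it satisfied and lower the
  -- other left-hand sides, giving a subsolution above the supremum.
  have hev : ∀ᶠ x in 𝓝[>] (v j), g j x < b j :=
    ((hg j).tendsto (v j)).mono_left nhdsWithin_le_nhds |>.eventually_lt_const hlt
  obtain ⟨x, hx, hxv⟩ := (hev.and self_mem_nhdsWithin).exists
  have hxv : v j < x := hxv
  have hu : Function.update v j x ∈ S := by
    intro i
    by_cases hi : i = j
    · subst hi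
      refine le_trans (le_of_eq ?_) hx.le
      simp only [g, Function.update_self]
      congr 1
      refine Finset.sum_congr rfl fun m _ => ?_
      by_cases h : m = i
      · subst h; simp
      · simp [h]
    · refine le_trans ?_ (hvS i)
      rw [hgv]
      rw [Function.update_of_ne hi]
      refine add_le_add le_rfl (Finset.sum_le_sum fun m _ => hqm ?_)
      by_cases h : m = j
      · subst h; rw [Function.update_self]; exact sub_le_sub_left hxv.le _
      · simp [h]
  have := hle _ hu j
  rw [Function.update_self] at this
  linarith

/-- At the index where `v - w` is largest, every `q` term for `v` is at least that for `w`; if `v`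
exceeded `w` there, strictness of `p` would contradict the equality of right-hand sides. -/
theorem solution_le_of_monotone {ι : Type*} [Fintype ι] {p q : ℝ → ℝ}
    (hpm : StrictMono p) (hqm : Monotone q) {b : ι → ℝ} {v w : ι → ℝ}
    (hv : ∀ j, p (v j) + ∑ m, q (v j - v m) = b j)
    (hw : ∀ j, p (w j) + ∑ m, q (w j - w m) = b j) : v ≤ w := by
  intro i
  have : Nonempty ι := ⟨i⟩
  obtain ⟨j, hj⟩ := Finite.exists_max fun j => v j - w j
  by_contra! hlt
  have h1 : w j < v j := by have := hj i; linarith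
  have h2 : ∑ m, q (w j - w m) ≤ ∑ m, q (v j - v m) :=
    Finset.sum_le_sum fun m _ => hqm (by have := hj m; linarith)
  have h3 := hpm h1
  have h4 := hv j
  have h5 := hw j
  linarith

theorem solution_unique_of_monotone {ι : Type*} [Fintype ι] {p q : ℝ → ℝ}
    (hpm : StrictMono p) (hqm : Monotone q) {b : ι → ℝ} {v w : ι → ℝ}
    (hv : ∀ j, p (v j) + ∑ m, q (v j - v m) = b j)
    (hw : ∀ j, p (w j) + ∑ m, q (w j - w m) = b j) : v = w :=
  le_antisymm (solution_le_of_monotone hpm hqm hv hw) (solution_le_of_monotone hpm hqm hw hv)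

/-! ### The scattering phase -/

/-- The continuous phase `p` with `sin (x + ζ) = -exp (-I p x) sin (x + conj ζ)`. -/
noncomputable def scatteringPhase (ζ : ℂ) (x : ℝ) : ℝ :=
  2 * (x + ζ.re) - 2 * (Complex.log (1 - Complex.exp (2 * Complex.I * (x + ζ)))).im

theorem norm_exp_two_I_mul_lt_one {ζ : ℂ} (hζ : 0 < ζ.im) (x : ℝ) :
    ‖Complex.exp (2 * Complex.I * (x + ζ))‖ < 1 := by
  rw [Complex.norm_exp, Real.exp_lt_one_iff]
  simp
  linarith

theorem one_sub_mem_slitPlane {z : ℂ} (hz : ‖z‖ < 1) : 1 - z ∈ Complex.slitPlane := by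
  left
  have := (Complex.re_le_norm z).trans_lt hz
  simpa using this

theorem scatteringPhase_add_pi (ζ : ℂ) (x : ℝ) :
    scatteringPhase ζ (x + Real.pi) = scatteringPhase ζ x + 2 * Real.pi := by
  have h : Complex.exp (2 * Complex.I * (((x + Real.pi : ℝ) : ℂ) + ζ)) =
      Complex.exp (2 * Complex.I * (x + ζ)) := by
    rw [← Complex.exp_periodic (2 * Complex.I * (x + ζ))]
    congr 1
    push_cast
    ring
  rw [scatteringPhase, scatteringPhase, h]
  ring

/-- With `z = exp (2i (x + ζ))` the derivative is `4 Re (1 / (1 - z)) - 2`, and `z ↦ 1 / (1 - z)`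
maps the unit disc into `Re > 1/2`. -/
theorem hasDerivAt_scatteringPhase {ζ : ℂ} (hζ : 0 < ζ.im) (x : ℝ) :
    ∃ D, 0 < D ∧ HasDerivAt (scatteringPhase ζ) D x := by
  set z := Complex.exp (2 * Complex.I * (x + ζ)) with hz
  have hz1 : ‖z‖ < 1 := norm_exp_two_I_mul_lt_one hζ x
  have hne : 1 - z ≠ 0 := Complex.slitPlane_ne_zero (one_sub_mem_slitPlane hz1)
  have h1 : HasDerivAt (fun y : ℝ => 2 * Complex.I * ((y : ℂ) + ζ)) (2 * Complex.I * 1) x :=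
    (Complex.ofRealCLM.hasDerivAt.add_const ζ).const_mul _
  have h2 := ((h1.cexp.const_sub 1).clog_real (one_sub_mem_slitPlane hz1))
  have h3 : HasDerivAt (fun y : ℝ =>
      (Complex.log (1 - Complex.exp (2 * Complex.I * (y + ζ)))).im)
      (-(z * (2 * Complex.I * 1)) / (1 - z)).im x :=
    Complex.imCLM.hasFDerivAt.comp_hasDerivAt x h2
  have h4 := (((hasDerivAt_id x).add_const ζ.re).const_mul 2).sub (h3.const_mul 2)
  refine ⟨_, ?_, h4⟩
  have h5 : (-(z * (2 * Complex.I * 1)) / (1 - z)).im = -2 * ((1 - z)⁻¹.re - 1) := by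
    have : -(z * (2 * Complex.I * 1)) / (1 - z) =
        ((-2 : ℝ) : ℂ) * (((1 - z)⁻¹ - 1) * Complex.I) := by
      push_cast
      field_simp
      ring
    rw [this, Complex.im_ofReal_mul]
    simp
  have h6 : 0 < Complex.normSq (1 - z) := Complex.normSq_pos.2 hne
  have h7 : Complex.normSq (1 - z) < 2 * (1 - z).re := by
    have : Complex.normSq z < 1 := by
      rw [Complex.normSq_eq_norm_sq]
      exact pow_lt_one₀ (norm_nonneg z) hz1 two_ne_zero
    rw [Complex.normSq_sub]
    simp
    linarith
  have h8 : 1 / 2 < (1 - z)⁻¹.re := by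
    rw [Complex.inv_re, lt_div_iff₀ h6]
    linarith
  rw [h5]
  linarith

theorem strictMono_scatteringPhase {ζ : ℂ} (hζ : 0 < ζ.im) : StrictMono (scatteringPhase ζ) :=
  strictMono_of_deriv_pos fun x => by
    obtain ⟨D, hD, h⟩ := hasDerivAt_scatteringPhase hζ x
    rwa [h.deriv]

theorem continuous_scatteringPhase {ζ : ℂ} (hζ : 0 < ζ.im) : Continuous (scatteringPhase ζ) :=
  continuous_iff_continuousAt.2 fun x =>
    (hasDerivAt_scatteringPhase hζ x).choose_spec.2.continuousAt

/-- Write `sin (x + ζ) = (i/2) exp (-i (x + ζ)) (1 - z)` and divide by the conjugate expression; the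
minus sign comes from `conj i = -i`. -/
theorem sin_add_eq_phase_mul {ζ : ℂ} (hζ : 0 < ζ.im) (x : ℝ) :
    Complex.sin (x + ζ) =
      -Complex.exp (-(scatteringPhase ζ x * Complex.I)) * Complex.sin (x + conj ζ) := by
  set z := Complex.exp (2 * Complex.I * (x + ζ)) with hz
  set w := Complex.log (1 - z) with hw
  have hne : 1 - z ≠ 0 := Complex.slitPlane_ne_zero
    (one_sub_mem_slitPlane (norm_exp_two_I_mul_lt_one hζ x))
  have hexp : Complex.exp w = 1 - z := Complex.exp_log hne
  have h1 : Complex.sin (x + ζ) =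
      Complex.exp (-((x + ζ) * Complex.I) + w) * Complex.I / 2 := by
    rw [Complex.exp_add, hexp, mul_sub, hz, mul_one, ← Complex.exp_add, Complex.sin]
    ring_nf
  have h2 : Complex.sin (x + conj ζ) =
      -(Complex.exp ((x + conj ζ) * Complex.I + conj w) * Complex.I / 2) := by
    have := congrArg conj h1
    rw [← Complex.sin_conj, map_div₀, map_mul, ← Complex.exp_conj] at this
    simp only [map_add, map_neg, map_mul, Complex.conj_ofReal, Complex.conj_I, map_ofNat] at this
    rw [this]
    ring_nf
  have h3 : (scatteringPhase ζ x : ℂ) * Complex.I =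
      (2 * x + ζ + conj ζ) * Complex.I - (w - conj w) := by
    rw [Complex.sub_conj, add_assoc, Complex.add_conj, scatteringPhase]
    push_cast
    ring
  rw [h2, h1, h3, neg_mul_neg, mul_div_assoc, mul_div_assoc, ← mul_assoc, ← Complex.exp_add]
  ring_nf

/-! ### Comparison of moduli off the real axis -/

/-- At fixed real part the modulus is thus an increasing function of `|Im z|`. -/
theorem norm_sin_sq (z : ℂ) : ‖Complex.sin z‖ ^ 2 = Real.cosh z.im ^ 2 - Real.cos z.re ^ 2 := by
  rw [Complex.sin_eq, ← Complex.normSq_eq_norm_sq, ← Complex.ofReal_sin, ← Complex.ofReal_cos,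
    ← Complex.ofReal_cosh, ← Complex.ofReal_sinh, ← Complex.ofReal_mul, ← Complex.ofReal_mul,
    Complex.normSq_add_mul_I]
  have h1 := Real.sin_sq_add_cos_sq z.re
  have h2 := Real.cosh_sq z.im
  linear_combination (Real.sinh z.im ^ 2 + 1) * h1 + (Real.sin z.re ^ 2 - 1) * h2

theorem norm_sin_lt {z w : ℂ} (hre : z.re = w.re) (him : |z.im| < |w.im|) :
    ‖Complex.sin z‖ < ‖Complex.sin w‖ := by
  refine lt_of_pow_lt_pow_left₀ 2 (norm_nonneg _) ?_
  rw [norm_sin_sq, norm_sin_sq, hre]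
  have := pow_lt_pow_left₀ (Real.cosh_lt_cosh.2 him) (Real.cosh_pos _).le two_ne_zero
  linarith

theorem norm_sin_le {z w : ℂ} (hre : z.re = w.re) (him : |z.im| ≤ |w.im|) :
    ‖Complex.sin z‖ ≤ ‖Complex.sin w‖ := by
  refine le_of_sq_le_sq ?_ (norm_nonneg _)
  rw [norm_sin_sq, norm_sin_sq, hre]
  have := pow_le_pow_left₀ (Real.cosh_pos _).le (Real.cosh_le_cosh.2 him) 2
  linarith

theorem prod_lt_prod_of_nonneg {ι : Type*} {s : Finset ι} (hs : s.Nonempty) {f g : ι → ℝ}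
    (hf : ∀ i ∈ s, 0 ≤ f i) (h : ∀ i ∈ s, f i < g i) : ∏ i ∈ s, f i < ∏ i ∈ s, g i := by
  by_cases h0 : ∃ i ∈ s, f i = 0
  · obtain ⟨i, hi, hi0⟩ := h0
    rw [Finset.prod_eq_zero hi hi0]
    exact Finset.prod_pos fun j hj => (hf j hj).trans_lt (h j hj)
  · push Not at h0
    exact Finset.prod_lt_prod_of_nonempty (fun i hi => (hf i hi).lt_of_ne' (h0 i hi)) h hs

theorem norm_sin_pos {z : ℂ} (hz : z.im ≠ 0) : 0 < ‖Complex.sin z‖ :=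
  (norm_nonneg (Complex.sin z.re)).trans_lt (norm_sin_lt (by simp) (by simpa using hz))

theorem norm_mul_prod_sin_lt {ι κ μ : Type*} [Fintype ι] [Nonempty ι] [Fintype κ] [Fintype μ]
    {a a' : ι → ℂ} {b b' : κ → μ → ℂ} (ha : ∀ i, (a i).re = (a' i).re)
    (ha' : ∀ i, |(a i).im| < |(a' i).im|) (hb : ∀ k m, (b k m).re = (b' k m).re)
    (hb' : ∀ k m, |(b k m).im| ≤ |(b' k m).im|) (hb0 : ∀ k m, (b' k m).im ≠ 0) :
    ‖(∏ i, Complex.sin (a i)) * ∏ k, ∏ m, Complex.sin (b k m)‖ <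
      ‖(∏ i, Complex.sin (a' i)) * ∏ k, ∏ m, Complex.sin (b' k m)‖ := by
  simp only [norm_mul, norm_prod]
  have h1 := prod_lt_prod_of_nonneg Finset.univ_nonempty
    (fun i _ => norm_nonneg (Complex.sin (a i))) fun i _ => norm_sin_lt (ha i) (ha' i)
  have h2 : ∏ k, ∏ m, ‖Complex.sin (b k m)‖ ≤ ∏ k, ∏ m, ‖Complex.sin (b' k m)‖ :=
    Finset.prod_le_prod (fun _ _ => Finset.prod_nonneg fun _ _ => norm_nonneg _) fun k _ =>
      Finset.prod_le_prod (fun _ _ => norm_nonneg _) fun m _ => norm_sin_le (hb k m) (hb' k m)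
  -- The strict inequality comes from the first product alone, so the second factor on the larger
  -- side must not vanish.
  have h3 : 0 < ∏ k, ∏ m, ‖Complex.sin (b' k m)‖ :=
    Finset.prod_pos fun k _ => Finset.prod_pos fun m _ => norm_sin_pos (hb0 k m)
  exact (mul_le_mul_of_nonneg_left h2 (Finset.prod_nonneg fun _ _ => norm_nonneg _)).trans_lt
    (mul_lt_mul_of_pos_right h1 h3)

/-! ### Removing singularities at simple zeros. -/

open Topology in
/-- A quotient of entire functions whose denominator has simple zeros, at which the numerator
vanishes, extends to an entire function. -/
theorem exists_entire_quotient {f q : ℂ → ℂ} (hf : Differentiable ℂ f) (hq : Differentiable ℂ q)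
    (h : ∀ u, q u = 0 → f u = 0 ∧ deriv q u ≠ 0) :
    ∃ g : ℂ → ℂ, Differentiable ℂ g ∧ ∀ u, q u ≠ 0 → g u = f u / q u := by
  classical
  refine ⟨fun u => if q u = 0 then deriv f u / deriv q u else f u / q u, fun u₀ => ?_,
    fun u hu => if_neg hu⟩
  by_cases h0 : q u₀ = 0
  · obtain ⟨hf0, hq0⟩ := h u₀ h0
    -- Near a common zero the quotient equals that of the divided differences `dslope f u₀` and
    -- `dslope q u₀`, whose denominator is nonzero at `u₀`.
    have dslope_diff : ∀ {F : ℂ → ℂ}, Differentiable ℂ F → Differentiable ℂ (dslope F u₀) :=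
      fun hF => differentiableOn_univ.1
        ((Complex.differentiableOn_dslope Filter.univ_mem).2 hF.differentiableOn)
    have hne : dslope q u₀ u₀ ≠ 0 := by rwa [dslope_same]
    have hev : ∀ᶠ u in 𝓝 u₀, dslope q u₀ u ≠ 0 :=
      (dslope_diff hq).continuous.continuousAt.eventually_ne hne
    refine (((dslope_diff hf) u₀).div ((dslope_diff hq) u₀) hne).congr_of_eventuallyEq ?_
    filter_upwards [hev] with u hu
    rcases eq_or_ne u u₀ with rfl | hu0
    · simp [h0, dslope_same]
    · rw [dslope_of_ne _ hu0, slope_def_field, h0, sub_zero] at hu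
      have hqu : q u ≠ 0 := fun hc => hu (by rw [hc, zero_div])
      have hs : u - u₀ ≠ 0 := sub_ne_zero.2 hu0
      rw [if_neg hqu, Pi.div_apply, dslope_of_ne _ hu0, dslope_of_ne _ hu0, slope_def_field,
        slope_def_field, h0, hf0, sub_zero, sub_zero, div_div_div_cancel_right₀ hs]
  · refine ((hf u₀).div (hq u₀) h0).congr_of_eventuallyEq ?_
    filter_upwards [hq.continuous.continuousAt.eventually_ne h0] with u hu
    rw [if_neg hu, Pi.div_apply]

/-! ### Consequences of the strong equations and reality of the roots. -/

namespace TrigBetheData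

variable {N K M : ℕ} (d : TrigBetheData N K)

theorem differentiable_baxterQ (v : Fin M → ℂ) : Differentiable ℂ (baxterQ v) := by
  unfold baxterQ
  fun_prop

theorem differentiable_calQ (v : Fin M → ℂ) : Differentiable ℂ (d.calQ v) := by
  unfold calQ alpha delta baxterQ
  fun_prop

theorem baxterQ_eq_zero_iff (v : Fin M → ℂ) (u : ℂ) :
    baxterQ v u = 0 ↔ ∃ (m : Fin M) (k : ℤ), u = v m + k * Real.pi := by
  simp only [baxterQ, Finset.prod_eq_zero_iff, Finset.mem_univ, true_and, Complex.sin_eq_zero_iff,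
    sub_eq_iff_eq_add']

theorem baxterQ_apply_self (v : Fin M → ℂ) (j : Fin M) : baxterQ v (v j) = 0 :=
  (baxterQ_eq_zero_iff v _).2 ⟨j, 0, by simp⟩

variable {d} in
theorem IsStrongSolution.exists_mul_eq {v : Fin M → ℂ} (h : d.IsStrongSolution v) :
    ∃ g : ℂ → ℂ, Differentiable ℂ g ∧ ∀ u, d.calQ v u = g u * baxterQ v u := by
  obtain ⟨g, hg, hgq⟩ := h
  refine ⟨g, hg, ?_⟩
  -- The zeros of `baxterQ` are countable, so the identity holds on a dense set and extends by
  -- continuity.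
  have hcount : {u | baxterQ v u = 0}.Countable := by
    have : {u | baxterQ v u = 0} = ⋃ m : Fin M, Set.range fun k : ℤ => v m + k * Real.pi := by
      ext u
      refine (baxterQ_eq_zero_iff v u).trans ?_
      simp only [Set.mem_iUnion, Set.mem_range, eq_comm]
    rw [this]
    exact Set.countable_iUnion fun m => Set.countable_range _
  refine congrFun (Continuous.ext_on (hcount.dense_compl ℂ) (d.differentiable_calQ v).continuous
    (hg.continuous.mul (differentiable_baxterQ v).continuous) fun u hu => ?_)
  have hu : baxterQ v u ≠ 0 := hu
  show d.calQ v u = g u * baxterQ v u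
  rw [hgq u hu, div_mul_cancel₀ _ hu]

variable {d} in
theorem IsStrongSolution.calQ_eq_zero {v : Fin M → ℂ} (h : d.IsStrongSolution v) (j : Fin M) :
    d.calQ v (v j) = 0 := by
  obtain ⟨g, -, hg⟩ := h.exists_mul_eq
  rw [hg, baxterQ_apply_self, mul_zero]

theorem norm_eq_of_calQ_eq_zero {v : Fin M → ℂ} {u : ℂ} (h : d.calQ v u = 0) :
    ‖(∏ n, Complex.sin (u + d.xi n)) * ∏ k, ∏ m, Complex.sin (u + d.eta k - v m)‖ =
      ‖(∏ n, Complex.sin (u + conj (d.xi n))) *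
        ∏ k, ∏ m, Complex.sin (u + conj (d.eta k) - v m)‖ := by
  have h1 := congrArg norm (eq_neg_of_add_eq_zero_left h)
  rw [norm_neg, alpha, delta, mul_assoc, mul_assoc, norm_mul, norm_mul ((-1) ^ (K + 1)),
    d.norm_Finf, norm_pow, norm_neg, norm_one, one_pow, one_mul, one_mul] at h1
  exact h1

/-- The roots of the Bethe equations are real. -/
theorem im_eq_zero_of_calQ_eq_zero (hN : 0 < N) {v : Fin M → ℂ} (h : ∀ j, d.calQ v (v j) = 0)
    (i : Fin M) : (v i).im = 0 := by
  have : Nonempty (Fin M) := ⟨i⟩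
  have : Nonempty (Fin N) := ⟨⟨0, hN⟩⟩
  obtain ⟨j, hj⟩ := Finite.exists_max fun i => (v i).im
  obtain ⟨l, hl⟩ := Finite.exists_min fun i => (v i).im
  -- At the highest root, if it lies above the axis, `ξ` and `η` move the arguments further from the
  -- axis than their conjugates do, strictly so for `ξ`; the two terms of `calQ` then have different
  -- moduli. Below the axis, at the lowest root, the inequality is reversed.
  have hup : (v j).im ≤ 0 := by
    by_contra! hpos
    refine (norm_mul_prod_sin_lt (fun n => ?_) (fun n => ?_) (fun k m => ?_) (fun k m => ?_)
      fun k m => ?_).ne' (d.norm_eq_of_calQ_eq_zero (h j))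
    · simp
    · have := d.xi_im_pos n
      simp only [Complex.add_im, Complex.conj_im]
      exact (abs_lt.2 ⟨by linarith, by linarith⟩).trans_le (le_abs_self _)
    · simp
    · have := d.eta_im_pos k
      have := hj m
      simp only [Complex.add_im, Complex.sub_im, Complex.conj_im]
      exact (abs_le.2 ⟨by linarith, by linarith⟩).trans (le_abs_self _)
    · have := d.eta_im_pos k
      have := hj m
      simp only [Complex.add_im, Complex.sub_im]
      exact ne_of_gt (by linarith)
  have hlow : 0 ≤ (v l).im := by
    by_contra! hneg
    refine (norm_mul_prod_sin_lt (fun n => ?_) (fun n => ?_) (fun k m => ?_) (fun k m => ?_)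
      fun k m => ?_).ne (d.norm_eq_of_calQ_eq_zero (h l))
    · simp
    · have := d.xi_im_pos n
      simp only [Complex.add_im, Complex.conj_im]
      exact (abs_lt.2 ⟨by linarith, by linarith⟩).trans_le (neg_le_abs _)
    · simp
    · have := d.eta_im_pos k
      have := hl m
      simp only [Complex.add_im, Complex.sub_im, Complex.conj_im]
      exact (abs_le.2 ⟨by linarith, by linarith⟩).trans (neg_le_abs _)
    · have := d.eta_im_pos k
      have := hl m
      simp only [Complex.add_im, Complex.sub_im, Complex.conj_im]
      exact ne_of_lt (by linarith)
  have := hj i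
  have := hl i
  linarith

/-! ### The logarithmic form of the equations -/

noncomputable def xiPhase (x : ℝ) : ℝ := ∑ n, scatteringPhase (d.xi n) x

noncomputable def etaPhase (x : ℝ) : ℝ := ∑ k, scatteringPhase (d.eta k) x

noncomputable def totalPhase (w : Fin M → ℝ) (x : ℝ) : ℝ :=
  d.xiPhase x + ∑ m, d.etaPhase (x - w m)

/-- The constant `c` such that the logarithmic Bethe equations read `Φ ∈ c + 2πℤ`. -/
noncomputable def phaseConst (M : ℕ) : ℝ := (d.Finf * (-1) ^ (N + K * M + K)).arg

theorem strictMono_xiPhase (hN : 0 < N) : StrictMono d.xiPhase := fun _ _ h =>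
  Finset.sum_lt_sum_of_nonempty ⟨⟨0, hN⟩, Finset.mem_univ _⟩ fun n _ =>
    strictMono_scatteringPhase (d.xi_im_pos n) h

theorem monotone_etaPhase : Monotone d.etaPhase := fun _ _ h =>
  Finset.sum_le_sum fun k _ => (strictMono_scatteringPhase (d.eta_im_pos k)).monotone h

theorem continuous_xiPhase : Continuous d.xiPhase :=
  continuous_finsetSum _ fun n _ => continuous_scatteringPhase (d.xi_im_pos n)

theorem continuous_etaPhase : Continuous d.etaPhase :=
  continuous_finsetSum _ fun k _ => continuous_scatteringPhase (d.eta_im_pos k)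

theorem xiPhase_add_pi (x : ℝ) : d.xiPhase (x + Real.pi) = d.xiPhase x + 2 * Real.pi * N := by
  simp only [xiPhase, scatteringPhase_add_pi, Finset.sum_add_distrib]
  simp
  ring

theorem etaPhase_add_pi (x : ℝ) : d.etaPhase (x + Real.pi) = d.etaPhase x + 2 * Real.pi * K := by
  simp only [etaPhase, scatteringPhase_add_pi, Finset.sum_add_distrib]
  simp
  ring

theorem etaPhase_add_int_mul_pi (x : ℝ) (k : ℤ) :
    d.etaPhase (x + k * Real.pi) = d.etaPhase x + k * (2 * Real.pi * K) := by
  have := periodic_add_mul (M := 1) (v := fun i : ℤ => d.etaPhase (x + i * Real.pi))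
    (p := 2 * Real.pi * K) (fun i => by
      rw [← d.etaPhase_add_pi]
      congr 1
      push_cast
      ring) 0 k
  simpa using this

theorem xiPhase_add_int_mul_pi (x : ℝ) (k : ℤ) :
    d.xiPhase (x + k * Real.pi) = d.xiPhase x + k * (2 * Real.pi * N) := by
  have := periodic_add_mul (M := 1) (v := fun i : ℤ => d.xiPhase (x + i * Real.pi))
    (p := 2 * Real.pi * N) (fun i => by
      rw [← d.xiPhase_add_pi]
      congr 1
      push_cast
      ring) 0 k
  simpa using this

theorem strictMono_totalPhase (hN : 0 < N) (w : Fin M → ℝ) : StrictMono (d.totalPhase w) :=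
  (d.strictMono_xiPhase hN).add_monotone fun _ _ h =>
    Finset.sum_le_sum fun m _ => d.monotone_etaPhase (sub_le_sub_right h (w m))

theorem totalPhase_add_int_mul_pi (w : Fin M → ℝ) (x : ℝ) (k : ℤ) :
    d.totalPhase w (x + k * Real.pi) =
      d.totalPhase w x + 2 * Real.pi * (k * ((K * M + N : ℕ) : ℝ)) := by
  simp only [totalPhase, xiPhase_add_int_mul_pi, add_sub_right_comm, etaPhase_add_int_mul_pi,
    Finset.sum_add_distrib]
  simp
  ring

theorem hasDerivAt_totalPhase (hN : 0 < N) (w : Fin M → ℝ) (x : ℝ) :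
    ∃ D, 0 < D ∧ HasDerivAt (d.totalPhase w) D x := by
  choose D hD h using fun n x => hasDerivAt_scatteringPhase (d.xi_im_pos n) x
  choose E hE h' using fun k x => hasDerivAt_scatteringPhase (d.eta_im_pos k) x
  refine ⟨∑ n, D n x + ∑ m, ∑ k, E k (x - w m), ?_, ?_⟩
  · have h1 : 0 < ∑ n, D n x :=
      Finset.sum_pos (fun n _ => hD n x) ⟨⟨0, hN⟩, Finset.mem_univ _⟩
    have h2 : 0 ≤ ∑ m, ∑ k, E k (x - w m) :=
      Finset.sum_nonneg fun m _ => Finset.sum_nonneg fun k _ => (hE k _).le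
    linarith
  · exact (HasDerivAt.fun_sum fun n _ => h n x).add (HasDerivAt.fun_sum fun m _ =>
      HasDerivAt.fun_sum fun k _ => (h' k (x - w m)).comp_sub_const x (w m))

/-- The common factor `∏ sin (u + conj (ξ n)) ∏ Q (u + conj (η k))`. -/
noncomputable def commonFactor (w : Fin M → ℝ) (u : ℂ) : ℂ :=
  (∏ n, Complex.sin (u + conj (d.xi n))) * ∏ k, baxterQ (fun m => (w m : ℂ)) (u + conj (d.eta k))

theorem differentiable_commonFactor (w : Fin M → ℝ) : Differentiable ℂ (d.commonFactor w) := by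
  unfold commonFactor baxterQ
  fun_prop

theorem commonFactor_ne_zero (w : Fin M → ℝ) (x : ℝ) : d.commonFactor w x ≠ 0 := by
  refine mul_ne_zero (Finset.prod_ne_zero_iff.2 fun n _ => ?_)
    (Finset.prod_ne_zero_iff.2 fun k _ => Finset.prod_ne_zero_iff.2 fun m _ => ?_)
  · exact norm_pos_iff.1 (norm_sin_pos (by simpa using (d.xi_im_pos n).ne'))
  · exact norm_pos_iff.1 (norm_sin_pos (by simpa using (d.eta_im_pos k).ne'))

theorem exp_phaseConst (M : ℕ) :
    Complex.exp (d.phaseConst M * Complex.I) = d.Finf * (-1) ^ (N + K * M + K) := by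
  have h : ‖d.Finf * (-1) ^ (N + K * M + K)‖ = 1 := by simp [d.norm_Finf]
  have := Complex.norm_mul_exp_arg_mul_I (d.Finf * (-1) ^ (N + K * M + K))
  rwa [h, Complex.ofReal_one, one_mul] at this

/-- The `N + K M` sine quotients contribute `(-1) ^ (N + K M) exp (-i Φ)`. Extracting `(-1) ^ K`
turns the sign of `delta` into `-1` and leaves the remaining signs and `Finf` as `exp (i c)`. -/
theorem calQ_ofReal (w : Fin M → ℝ) (x : ℝ) :
    d.calQ (fun m => (w m : ℂ)) x = (-1) ^ K * d.commonFactor w x *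
      (Complex.exp ((d.phaseConst M - d.totalPhase w x : ℝ) * Complex.I) - 1) := by
  have h1 : ∏ n, Complex.sin (x + d.xi n) = (-1) ^ N * Complex.exp (-(d.xiPhase x * Complex.I)) *
      ∏ n, Complex.sin (x + conj (d.xi n)) := by
    rw [xiPhase, Complex.ofReal_sum, Finset.sum_mul, ← Finset.sum_neg_distrib, Complex.exp_sum]
    have : ((-1) ^ N : ℂ) = ∏ _n : Fin N, (-1) := by simp
    rw [this, ← Finset.prod_mul_distrib, ← Finset.prod_mul_distrib]
    refine Finset.prod_congr rfl fun n _ => ?_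
    rw [sin_add_eq_phase_mul (d.xi_im_pos n), neg_one_mul]
  have h2 : ∏ k, baxterQ (fun m => (w m : ℂ)) (x + d.eta k) =
      (-1) ^ (K * M) * Complex.exp (-((∑ m, d.etaPhase (x - w m) : ℝ) * Complex.I)) *
      ∏ k, baxterQ (fun m => (w m : ℂ)) (x + conj (d.eta k)) := by
    have hswap : ∑ m, d.etaPhase (x - w m) = ∑ k, ∑ m, scatteringPhase (d.eta k) (x - w m) :=
      Finset.sum_comm
    rw [hswap, Complex.ofReal_sum, Finset.sum_mul, ← Finset.sum_neg_distrib, Complex.exp_sum]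
    have : ((-1) ^ (K * M) : ℂ) = ∏ _k : Fin K, ∏ _m : Fin M, (-1) := by
      simp [mul_comm K M, pow_mul]
    rw [this, ← Finset.prod_mul_distrib, ← Finset.prod_mul_distrib]
    refine Finset.prod_congr rfl fun k _ => ?_
    rw [baxterQ, baxterQ, Complex.ofReal_sum, Finset.sum_mul, ← Finset.sum_neg_distrib,
      Complex.exp_sum, ← Finset.prod_mul_distrib, ← Finset.prod_mul_distrib]
    refine Finset.prod_congr rfl fun m _ => ?_
    have := sin_add_eq_phase_mul (d.eta_im_pos k) (x - w m)
    rw [neg_one_mul]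
    push_cast at this ⊢
    rw [← sub_add_eq_add_sub, this, sub_add_eq_add_sub]
  have h3 : ((-1) ^ K * (-1) ^ K : ℂ) = 1 := by rw [← mul_pow]; simp
  rw [Complex.ofReal_sub, sub_mul, sub_eq_add_neg (_ * Complex.I), Complex.exp_add, exp_phaseConst, calQ, alpha,
    delta, h1, h2, totalPhase, Complex.ofReal_add, add_mul, neg_add, Complex.exp_add, commonFactor,
    pow_add, pow_add, pow_succ]
  linear_combination (-(d.Finf * (-1) ^ N * (-1) ^ (K * M) *
    Complex.exp (-(d.xiPhase x * Complex.I)) *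
    Complex.exp (-((∑ m, d.etaPhase (x - w m) : ℝ) * Complex.I)) *
    ((∏ n, Complex.sin (x + conj (d.xi n))) *
      ∏ k, baxterQ (fun m => (w m : ℂ)) (x + conj (d.eta k))))) * h3

theorem calQ_ofReal_eq_zero_iff (w : Fin M → ℝ) (x : ℝ) :
    d.calQ (fun m => (w m : ℂ)) x = 0 ↔
      ∃ n : ℤ, d.totalPhase w x = d.phaseConst M + 2 * Real.pi * n := by
  have h1 : ((-1) ^ K * d.commonFactor w x : ℂ) ≠ 0 :=
    mul_ne_zero (by simp) (d.commonFactor_ne_zero w x)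
  rw [calQ_ofReal, mul_eq_zero, or_iff_right h1, sub_eq_zero, Complex.exp_eq_one_iff]
  constructor
  · rintro ⟨n, hn⟩
    refine ⟨-n, ?_⟩
    rw [← mul_assoc] at hn
    have := mul_right_cancel₀ Complex.I_ne_zero hn
    have : d.phaseConst M - d.totalPhase w x = n * (2 * Real.pi) := by exact_mod_cast this
    push_cast
    linarith
  · rintro ⟨n, hn⟩
    refine ⟨-n, ?_⟩
    rw [hn]
    push_cast
    ring

/-- The zeros of `calQ` on the real axis are simple. -/
theorem deriv_calQ_ne_zero (hN : 0 < N) (w : Fin M → ℝ) (x : ℝ)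
    (hx : d.calQ (fun m => (w m : ℂ)) x = 0) : deriv (d.calQ fun m => (w m : ℂ)) x ≠ 0 := by
  intro h0
  -- The complex derivative is computed along the real axis, where `calQ_ofReal` applies: at a zero
  -- only the exponential factor is differentiated, giving a nonzero multiple of `D`.
  have hQ : HasDerivAt (fun y : ℝ => d.calQ (fun m => (w m : ℂ)) y) 0 x := by
    rw [← h0]
    exact ((d.differentiable_calQ _) x).hasDerivAt.comp_ofReal
  obtain ⟨D, hD, hΦ⟩ := d.hasDerivAt_totalPhase hN w x
  have hE := ((((hΦ.const_sub (d.phaseConst M)).ofReal_comp).mul_const Complex.I).cexp).sub_const 1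
  have hR : HasDerivAt (fun y : ℝ => (-1) ^ K * d.commonFactor w y)
      ((-1) ^ K * deriv (d.commonFactor w) x) x :=
    (((d.differentiable_commonFactor w) x).hasDerivAt.comp_ofReal).const_mul _
  have hP := hR.mul hE
  have heq : (fun y : ℝ => d.calQ (fun m => (w m : ℂ)) y) =
      (fun y : ℝ => (-1) ^ K * d.commonFactor w y) * fun y : ℝ =>
        Complex.exp ((d.phaseConst M - d.totalPhase w y : ℝ) * Complex.I) - 1 :=
    funext fun y => d.calQ_ofReal w y
  rw [← heq] at hP
  have h1 := hP.unique hQ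
  have h2 : ((-1) ^ K * d.commonFactor w x : ℂ) ≠ 0 :=
    mul_ne_zero (by simp) (d.commonFactor_ne_zero w x)
  rw [calQ_ofReal, mul_eq_zero, or_iff_right h2] at hx
  rw [hx, mul_zero, zero_add, mul_eq_zero, or_iff_right h2, mul_eq_zero,
    or_iff_right (Complex.exp_ne_zero _), mul_eq_zero, or_iff_left Complex.I_ne_zero] at h1
  have : -D = 0 := by exact_mod_cast h1
  linarith

/-- The strong Bethe equations are equivalent to the logarithmic Bethe equations for real roots
that are pairwise distinct modulo `π`. -/
theorem isStrongSolution_ofReal_iff (hN : 0 < N) (w : Fin M → ℝ) :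
    d.IsStrongSolution (fun m => (w m : ℂ)) ↔
      (∀ i j, (∃ k : ℤ, w i = w j + k • Real.pi) → i = j) ∧
      ∀ j, ∃ n : ℤ, d.totalPhase w (w j) = d.phaseConst M + 2 * Real.pi * n := by
  constructor
  · intro h
    refine ⟨?_, fun j => (d.calQ_ofReal_eq_zero_iff w (w j)).1 (h.calQ_eq_zero j)⟩
    rintro i j ⟨k, hk⟩
    by_contra hij
    -- Two roots equal mod `π` give `baxterQ` a double zero, so `calQ = g * baxterQ` has zero
    -- derivative there, against simplicity.
    refine d.deriv_calQ_ne_zero hN w (w j) (h.calQ_eq_zero j) ?_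
    obtain ⟨g, hg, hgq⟩ := h.exists_mul_eq
    have hi : Complex.sin ((w j : ℂ) - w i) = 0 :=
      Complex.sin_eq_zero_iff.2 ⟨-k, by rw [hk]; push_cast; simp⟩
    have h1 : baxterQ (fun m => (w m : ℂ)) = fun u => Complex.sin (u - w j) *
        (Complex.sin (u - w i) *
          ∏ m ∈ (Finset.univ.erase j).erase i, Complex.sin (u - w m)) := by
      funext u
      rw [Finset.mul_prod_erase _ (fun m => Complex.sin (u - w m))
        (Finset.mem_erase.2 ⟨hij, Finset.mem_univ i⟩),
        Finset.mul_prod_erase _ (fun m => Complex.sin (u - w m)) (Finset.mem_univ j), baxterQ]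
    have h2 : HasDerivAt (baxterQ fun m => (w m : ℂ)) 0 (w j) := by
      rw [h1]
      have hd1 : DifferentiableAt ℂ (fun u : ℂ => Complex.sin (u - w j)) (w j) := by fun_prop
      have hd2 : DifferentiableAt ℂ (fun u : ℂ => Complex.sin (u - w i) *
          ∏ m ∈ (Finset.univ.erase j).erase i, Complex.sin (u - w m)) (w j) := by fun_prop
      refine (hd1.hasDerivAt.fun_mul hd2.hasDerivAt).congr_deriv ?_
      simp [hi]
    have h3 := (hg (w j)).hasDerivAt.mul h2
    rw [baxterQ_apply_self (fun m => (w m : ℂ)) j, mul_zero, mul_zero, add_zero] at h3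
    rw [show d.calQ (fun m => (w m : ℂ)) = g * baxterQ (fun m => (w m : ℂ)) from funext hgq]
    exact h3.deriv
  · rintro ⟨hdist, hphase⟩
    refine exists_entire_quotient (d.differentiable_calQ _) (differentiable_baxterQ _)
      fun u hu => ?_
    obtain ⟨j, k, rfl⟩ := (baxterQ_eq_zero_iff _ u).1 hu
    constructor
    · obtain ⟨n, hn⟩ := hphase j
      have := (d.calQ_ofReal_eq_zero_iff w (w j + k * Real.pi)).2
        ⟨n + k * ((K * M + N : ℕ) : ℤ), by
          rw [totalPhase_add_int_mul_pi, hn]; push_cast; ring⟩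
      push_cast at this
      exact this
    · have h1 : baxterQ (fun m => (w m : ℂ)) = fun u => Complex.sin (u - w j) *
          ∏ m ∈ Finset.univ.erase j, Complex.sin (u - w m) := by
        funext u
        rw [Finset.mul_prod_erase _ (fun m => Complex.sin (u - w m)) (Finset.mem_univ j), baxterQ]
      have hs : Complex.sin ((w j : ℂ) + k * Real.pi - w j) = 0 :=
        Complex.sin_eq_zero_iff.2 ⟨k, by ring⟩
      have hd1 : HasDerivAt (fun u : ℂ => Complex.sin (u - w j))
          (Complex.cos ((w j : ℂ) + k * Real.pi - w j)) ((w j : ℂ) + k * Real.pi) :=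
        (Complex.hasDerivAt_sin _).comp_sub_const _ _
      have hd2 : DifferentiableAt ℂ (fun u : ℂ =>
          ∏ m ∈ Finset.univ.erase j, Complex.sin (u - w m)) ((w j : ℂ) + k * Real.pi) := by
        fun_prop
      rw [h1, (hd1.fun_mul hd2.hasDerivAt).deriv, hs, zero_mul, add_zero]
      refine mul_ne_zero (fun hc => ?_) (Finset.prod_ne_zero_iff.2 fun m hm hc => ?_)
      · have := Complex.sin_sq_add_cos_sq ((w j : ℂ) + k * Real.pi - w j)
        rw [hs, hc] at this
        simp at this
      · obtain ⟨l, hl⟩ := Complex.sin_eq_zero_iff.1 hc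
        refine Finset.ne_of_mem_erase hm (hdist m j ⟨k - l, ?_⟩)
        have h4 : (w m : ℂ) = w j + (k - l) * Real.pi := by linear_combination -hl
        rw [zsmul_eq_mul]
        push_cast
        exact_mod_cast h4

end TrigBetheData

/-! ### Correspondence between solutions and shift orbits of quantum numbers. -/

theorem exists_fin_add_mul {M : ℕ} [NeZero M] (i : ℤ) :
    ∃ (j : Fin M) (k : ℤ), i = (j : ℕ) + k * M := by
  have h0 := Int.emod_nonneg i (natCast_pos_of_neZero (M := M)).ne'
  have h1 := Int.emod_lt_of_pos i (natCast_pos_of_neZero (M := M))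
  refine ⟨⟨(i % M).toNat, by omega⟩, i / M, ?_⟩
  rw [Int.toNat_of_nonneg h0, mul_comm]
  exact (Int.emod_add_mul_ediv i M).symm

namespace TrigBetheData

variable {N K M : ℕ} (d : TrigBetheData N K)

theorem exists_roots (hN : 0 < N) (n : ℤ → ℤ) :
    ∃ w : Fin M → ℝ, ∀ j, d.totalPhase w (w j) = d.phaseConst M + 2 * Real.pi * n j := by
  have hπN : 0 < 2 * Real.pi * N := by positivity
  refine exists_solution_of_monotone d.continuous_xiPhase d.continuous_etaPhase
    (d.strictMono_xiPhase hN).monotone d.monotone_etaPhase (fun B => ?_) (fun B => ?_)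
    (fun j : Fin M => d.phaseConst M + 2 * Real.pi * n j)
  · obtain ⟨k, hk⟩ := exists_int_lt ((B - d.xiPhase 0) / (2 * Real.pi * N))
    refine ⟨0 + k * Real.pi, ?_⟩
    rw [lt_div_iff₀ hπN] at hk
    rw [xiPhase_add_int_mul_pi]
    linarith
  · obtain ⟨k, hk⟩ := exists_int_gt ((B - d.xiPhase 0) / (2 * Real.pi * N))
    refine ⟨0 + k * Real.pi, ?_⟩
    rw [div_lt_iff₀ hπN] at hk
    rw [xiPhase_add_int_mul_pi]
    linarith

theorem roots_unique (hN : 0 < N) {b : Fin M → ℝ} {w w' : Fin M → ℝ}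
    (h : ∀ j, d.totalPhase w (w j) = b j) (h' : ∀ j, d.totalPhase w' (w' j) = b j) : w = w' :=
  solution_unique_of_monotone (d.strictMono_xiPhase hN) d.monotone_etaPhase h h'

/-- Each unit of index shift replaces one root by itself plus `π`, which costs `2π K`. Relabelling
the roots thus acts on quantum numbers as `PeriodicSeq.shift K`. -/
theorem totalPhase_shift {u : ℤ → ℝ} (hu : ∀ i, u (i + M) = u i + Real.pi) (k : ℤ) (x : ℝ) :
    d.totalPhase (fun m : Fin M => u ((m : ℕ) + k)) x =
      d.totalPhase (fun m : Fin M => u (m : ℕ)) x - 2 * Real.pi * (K * k) := by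
  have h := sum_shift (g := fun i => d.etaPhase (x - u i)) (M := M) (p := -(2 * Real.pi * K))
    (fun i => by
      have := d.etaPhase_add_pi (x - u (i + M))
      rw [hu, sub_add_eq_sub_sub, sub_add_cancel] at this
      rw [hu, sub_add_eq_sub_sub]
      linarith) k
  simp only [totalPhase]
  rw [h, zsmul_eq_mul]
  ring

theorem totalPhase_congr {w w' : Fin M → ℝ} (h : SameRoots (fun m => (w m : ℂ))
    fun m => (w' m : ℂ)) :
    ∃ l : ℤ, ∀ x, d.totalPhase w' x = d.totalPhase w x + 2 * Real.pi * l := by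
  obtain ⟨σ, hσ⟩ := h
  choose k hk using hσ
  have hk' : ∀ i, w' i = w (σ i) + k i * Real.pi := fun i => by
    have := hk i
    dsimp only at this
    exact_mod_cast this
  refine ⟨-(K * ∑ i, k i), fun x => ?_⟩
  have h1 : ∀ i, d.etaPhase (x - w' i) = d.etaPhase (x - w (σ i)) - k i * (2 * Real.pi * K) := by
    intro i
    have := d.etaPhase_add_int_mul_pi (x - w (σ i)) (-k i)
    rw [hk', show x - (w (σ i) + k i * Real.pi) = x - w (σ i) + (-k i : ℤ) * Real.pi by
      push_cast; ring, this]
    push_cast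
    ring
  simp only [totalPhase, h1, Finset.sum_sub_distrib, ← Finset.sum_mul]
  rw [Equiv.sum_comp σ fun m => d.etaPhase (x - w m)]
  push_cast
  ring

theorem sameRoots_ofReal {w w' : Fin M → ℝ}
    (hw' : ∀ i j, (∃ k : ℤ, w' i = w' j + k • Real.pi) → i = j)
    (h : ∀ i, ∃ (j : Fin M) (k : ℤ), w' i = w j + k • Real.pi) :
    SameRoots (fun m => (w m : ℂ)) fun m => (w' m : ℂ) := by
  choose σ k hσ using h
  have hinj : Function.Injective σ := fun i j hij => hw' i j ⟨k i - k j, by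
    rw [hσ i, hσ j, hij, sub_zsmul]; abel⟩
  refine ⟨Equiv.ofBijective σ (Finite.injective_iff_bijective.1 hinj), fun i => ⟨k i, ?_⟩⟩
  have := hσ i
  rw [zsmul_eq_mul] at this
  simp only [Equiv.ofBijective_apply]
  exact_mod_cast this

/-- The periodic sequence of roots for the quantum numbers `n`. -/
theorem exists_rootSeq [NeZero M] (hN : 0 < N) (n : PeriodicSeq M (K * M + N)) :
    ∃ u : ℤ → ℝ, StrictMono u ∧ (∀ i, u (i + M) = u i + Real.pi) ∧
      ∀ i, d.totalPhase (fun m : Fin M => u (m : ℕ)) (u i) =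
        d.phaseConst M + 2 * Real.pi * n.toFun i := by
  obtain ⟨w, hw⟩ := d.exists_roots (M := M) hN n.toFun
  let u := periodicExtension Real.pi w
  have hu : ∀ i, u (i + M) = u i + Real.pi := periodicExtension_add _ _
  have huw : (fun m : Fin M => u (m : ℕ)) = w := funext (periodicExtension_coe _ _)
  have hphase : ∀ i, d.totalPhase (fun m : Fin M => u (m : ℕ)) (u i) =
      d.phaseConst M + 2 * Real.pi * n.toFun i := by
    intro i
    obtain ⟨j, k, rfl⟩ := exists_fin_add_mul (M := M) i
    rw [huw, periodic_add_mul hu, periodic_add_mul n.periodic, zsmul_eq_mul,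
      totalPhase_add_int_mul_pi, show u (j : ℕ) = w j from congrFun huw j, hw,
      smul_eq_mul]
    push_cast
    ring
  refine ⟨u, fun i j hij => ?_, hu, hphase⟩
  -- The roots inherit the order of the quantum numbers because `Φ` is strictly increasing.
  rw [← (d.strictMono_totalPhase hN fun m : Fin M => u (m : ℕ)).lt_iff_lt, hphase, hphase]
  have : (n.toFun i : ℝ) < n.toFun j := by exact_mod_cast n.strictMono hij
  have := Real.pi_pos
  gcongr

noncomputable def rootSeq [NeZero M] (hN : 0 < N) (n : PeriodicSeq M (K * M + N)) : ℤ → ℝ :=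
  (d.exists_rootSeq hN n).choose

section rootSeq

variable [NeZero M] (hN : 0 < N) (n : PeriodicSeq M (K * M + N))

theorem strictMono_rootSeq : StrictMono (d.rootSeq hN n) :=
  (d.exists_rootSeq hN n).choose_spec.1

theorem rootSeq_add (i : ℤ) : d.rootSeq hN n (i + M) = d.rootSeq hN n i + Real.pi :=
  (d.exists_rootSeq hN n).choose_spec.2.1 i

theorem totalPhase_rootSeq (i : ℤ) :
    d.totalPhase (fun m : Fin M => d.rootSeq hN n (m : ℕ)) (d.rootSeq hN n i) =
      d.phaseConst M + 2 * Real.pi * n.toFun i :=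
  (d.exists_rootSeq hN n).choose_spec.2.2 i

theorem rootSeq_eq {u : ℤ → ℝ} (hu : ∀ i, u (i + M) = u i + Real.pi)
    (h : ∀ i : Fin M, d.totalPhase (fun m : Fin M => u (m : ℕ)) (u (i : ℕ)) =
      d.phaseConst M + 2 * Real.pi * n.toFun (i : ℕ)) : d.rootSeq hN n = u :=
  eq_of_periodic_of_eq_on (d.rootSeq_add hN n) hu fun i => congrFun
    (d.roots_unique hN (fun j => d.totalPhase_rootSeq hN n (j : ℕ)) h) i

theorem rootSeq_distinct (i j : Fin M)
    (h : ∃ k : ℤ, d.rootSeq hN n (i : ℕ) = d.rootSeq hN n (j : ℕ) + k • Real.pi) : i = j :=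
  eq_of_strictMono_periodic (d.strictMono_rootSeq hN n) (d.rootSeq_add hN n) i j h

/-- The solution of the strong Bethe equations with quantum numbers `n`. -/
noncomputable def solutionOf : d.DistinctSolution M :=
  Quotient.mk (d.solutionSetoid M) ⟨fun m : Fin M => (d.rootSeq hN n (m : ℕ) : ℂ),
    (d.isStrongSolution_ofReal_iff hN fun m : Fin M => d.rootSeq hN n (m : ℕ)).2
      ⟨d.rootSeq_distinct hN n, fun j => ⟨_, d.totalPhase_rootSeq hN n (j : ℕ)⟩⟩⟩

/-- Equal roots mod `π` mean equal ranges of the increasing root sequences, hence an index shift,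
and `totalPhase_shift` reads off its effect on `n`. Conversely, the shifted root sequence solves the
equations for the shifted `n`, so uniqueness applies. -/
theorem solutionOf_eq_iff (n' : PeriodicSeq M (K * M + N)) :
    d.solutionOf hN n = d.solutionOf hN n' ↔ ∃ k : ℤ, n' = n.shift K k := by
  have hq : d.solutionOf hN n = d.solutionOf hN n' ↔
      SameRoots (fun m : Fin M => (d.rootSeq hN n (m : ℕ) : ℂ))
        fun m : Fin M => (d.rootSeq hN n' (m : ℕ) : ℂ) := Quotient.eq
  rw [hq]
  constructor
  · intro h
    have hsub : ∀ {n n' : PeriodicSeq M (K * M + N)},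
        SameRoots (fun m : Fin M => (d.rootSeq hN n (m : ℕ) : ℂ))
          (fun m : Fin M => (d.rootSeq hN n' (m : ℕ) : ℂ)) →
        Set.range (d.rootSeq hN n') ⊆ Set.range (d.rootSeq hN n) := by
      rintro n n' ⟨σ, hσ⟩ x hx
      obtain ⟨i, k, rfl⟩ := (mem_range_of_periodic (d.rootSeq_add hN n') x).1 hx
      obtain ⟨l, hl⟩ := hσ i
      have hl' : d.rootSeq hN n' (i : ℕ) = d.rootSeq hN n (σ i : ℕ) + l * Real.pi := by
        dsimp only at hl
        exact_mod_cast hl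
      refine (mem_range_of_periodic (d.rootSeq_add hN n) _).2 ⟨σ i, l + k, ?_⟩
      rw [hl', add_zsmul, zsmul_eq_mul _ l, add_assoc]
    obtain ⟨k, hk⟩ := shift_of_range_eq (d.strictMono_rootSeq hN n) (d.strictMono_rootSeq hN n')
      ((hsub ((sameRoots_equivalence M).symm h)).antisymm (hsub h))
    refine ⟨k, PeriodicSeq.ext (funext fun i => ?_)⟩
    have h1 := d.totalPhase_rootSeq hN n' i
    have h2 : (fun m : Fin M => d.rootSeq hN n' (m : ℕ)) =
        fun m : Fin M => d.rootSeq hN n ((m : ℕ) + k) := funext fun m => hk _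
    rw [h2, hk, d.totalPhase_shift (d.rootSeq_add hN n), totalPhase_rootSeq] at h1
    have h3 : 2 * Real.pi * (n.toFun (i + k) - K * k - n'.toFun i : ℝ) = 0 := by linarith
    rw [mul_eq_zero, or_iff_right (by positivity)] at h3
    have h4 : n.toFun (i + k) - K * k - n'.toFun i = 0 := by exact_mod_cast h3
    show n'.toFun i = n.toFun (i + k) - K * k
    linarith
  · rintro ⟨k, rfl⟩
    have hk : d.rootSeq hN (n.shift K k) = fun i => d.rootSeq hN n (i + k) := by
      refine d.rootSeq_eq hN _ (fun i => ?_) fun i => ?_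
      · rw [add_right_comm, rootSeq_add]
      · rw [d.totalPhase_shift (d.rootSeq_add hN n), totalPhase_rootSeq]
        simp only [PeriodicSeq.shift]
        push_cast
        ring
    refine sameRoots_ofReal (d.rootSeq_distinct hN _) fun i => ?_
    exact (mem_range_of_periodic (d.rootSeq_add hN n) _).1 ⟨(i : ℕ) + k, (congrFun hk _).symm⟩

/-- The sorted periodic extension of the roots has integral quantum numbers; they increase and have
period increment `K M + N` because `Φ` does so up to the factor `2π`. Uniqueness then recovers the
roots. -/
theorem solutionOf_surjective : Function.Surjective (d.solutionOf (M := M) hN) := by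
  rintro ⟨v, hv⟩
  obtain ⟨w, rfl⟩ : ∃ w : Fin M → ℝ, v = fun m => (w m : ℂ) :=
    ⟨fun m => (v m).re, funext fun m => Complex.ext (by simp)
      (by simpa using d.im_eq_zero_of_calQ_eq_zero hN hv.calQ_eq_zero m)⟩
  obtain ⟨hdist, hphase⟩ := (d.isStrongSolution_ofReal_iff hN w).1 hv
  obtain ⟨u, hu, hper, hrange⟩ := exists_strictMono_periodic Real.pi_pos w hdist
  have hsame : SameRoots (fun m => (w m : ℂ)) fun m : Fin M => (u (m : ℕ) : ℂ) :=
    sameRoots_ofReal (w' := fun m : Fin M => u (m : ℕ)) (eq_of_strictMono_periodic hu hper)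
      fun i => (hrange _).1 ⟨_, rfl⟩
  obtain ⟨l, hl⟩ := d.totalPhase_congr hsame
  have hint : ∀ i : ℤ, ∃ n : ℤ, d.totalPhase (fun m : Fin M => u (m : ℕ)) (u i) =
      d.phaseConst M + 2 * Real.pi * n := by
    intro i
    obtain ⟨j, k, hjk⟩ := (hrange (u i)).1 ⟨i, rfl⟩
    obtain ⟨n, hn⟩ := hphase j
    refine ⟨n + k * (K * M + N : ℕ) + l, ?_⟩
    rw [hl, hjk, zsmul_eq_mul, totalPhase_add_int_mul_pi, hn]
    push_cast
    ring
  choose n hn using hint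
  have hπ := Real.pi_pos
  let n' : PeriodicSeq M (K * M + N) := ⟨n, fun i j hij => by
      have h1 := d.strictMono_totalPhase hN (fun m : Fin M => u (m : ℕ)) (hu hij)
      rw [hn, hn, add_lt_add_iff_left, mul_lt_mul_iff_right₀ (by positivity)] at h1
      exact_mod_cast h1, fun i => by
      have h1 := hn (i + M)
      have h2 := d.totalPhase_add_int_mul_pi (fun m : Fin M => u (m : ℕ)) (u i) 1
      rw [Int.cast_one, one_mul, one_mul] at h2
      rw [hper, h2, hn, add_assoc, add_right_inj, ← mul_add] at h1
      have h3 := mul_left_cancel₀ (by positivity) h1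
      exact_mod_cast h3.symm⟩
  refine ⟨n', ?_⟩
  refine (Quotient.sound (s := d.solutionSetoid M) ?_ : _ = _)
  have hroot : d.rootSeq hN n' = u := d.rootSeq_eq hN n' hper fun i => hn _
  show SameRoots (fun m : Fin M => (d.rootSeq hN n' (m : ℕ) : ℂ)) fun m => (w m : ℂ)
  rw [hroot]
  exact (sameRoots_equivalence M).symm hsame

end rootSeq

theorem card_distinctSolution (hN : 0 < N) (M : ℕ) :
    Finite (d.DistinctSolution M) ∧
      (Nat.card (d.DistinctSolution M) : ℚ) = betheNumber K N M := by
  rcases Nat.eq_zero_or_pos M with rfl | hM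
  -- For `M = 0` no sequence satisfies `n (i + 0) = n i + N`, yet the empty vector is a solution, so
  -- this case is separate.
  · have hv : d.IsStrongSolution (Fin.elim0 : Fin 0 → ℂ) :=
      ⟨d.calQ Fin.elim0, d.differentiable_calQ _, fun u _ => by simp [baxterQ]⟩
    have : Unique (d.DistinctSolution 0) :=
      { default := Quotient.mk _ ⟨_, hv⟩
        uniq := by
          rintro ⟨v, h⟩
          exact congrArg (Quotient.mk _) (Subtype.ext (Subsingleton.elim _ _)) }
    refine ⟨inferInstance, ?_⟩
    rw [Nat.card_unique, betheNumber_zero_right K hN, Nat.cast_one]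
  · have : NeZero M := ⟨hM.ne'⟩
    exact card_of_shift_orbits hN rfl (d.solutionOf hN) (d.solutionOf_surjective hN)
      (d.solutionOf_eq_iff hN)

end TrigBetheData

theorem mainTheorem4 (K N : ℕ) (hK : 0 < K) (hN : 0 < N) :
    -- the number of distinct solutions, for every choice of the parameters and every `M`
    (∀ (d : TrigBetheData N K) (M : ℕ),
      Finite (d.DistinctSolution M) ∧ (Nat.card (d.DistinctSolution M) : ℚ) = betheNumber K N M) ∧
    -- the two expressions for `C_M^{(K,N)}` agree
    (∀ M : ℕ, 0 < M →
      (N : ℚ) / M * ((K * M + N - 1).choose (M - 1) : ℚ) = betheNumber K N M) ∧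
    -- for `N = 1` these are the Fuss-Catalan numbers
    (∀ M : ℕ, betheNumber K 1 M = fussCatalan K M) ∧
    -- the generating function is the `N`-th power of that of the Fuss-Catalan numbers
    PowerSeries.mk (fun M => betheNumber K N M) =
      (PowerSeries.mk (fun M => fussCatalan K M)) ^ N := by
  refine ⟨fun d M => d.card_distinctSolution hN M,
    fun M hM => (betheNumber_eq_choose_pred N hM hK).symm, betheNumber_one_eq_fussCatalan hK, ?_⟩
  simp only [← betheNumber_one_eq_fussCatalan hK]
  rw [← betheSeries_eq_mk K hN, ← betheSeries_eq_mk K one_pos, betheSeries_eq_pow hK N]
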